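/- Notation. For $S\subseteq\mathbb C$ and $r>0$ let $\mathcal B_r(S)=\{z\in\mathbb C:\exists y\in S,\ |z-y|<r\}$, $\mathcal B_r(z_0)=\mathcal B_r(\{z_0\})$, and for $\boldsymbol\delta=(\delta_1,\dots,\delta_k)\in(0,\infty)^k$ let $\mathcal B_{\boldsymbol\delta}([-1,1])=\prod_{j=1}^k\mathcal B_{\delta_j}([-1,1])\subseteq\mathbb C^k$ and $\mathcal B_{\boldsymbol\delta}=\prod_{j=1}^k\mathcal B_{\delta_j}(0)$. Write $\boldsymbol x_{[k]}=(x_1,\dots,x_k)$, and let $\mu$ be the normalized Lebesgue (probability) measure on $[-1,1]^n$, for every $n$. $C^1$ on an open subset of $\mathbb C^k$ is meant in the complex sense, i.e. holomorphic. A probability density on $[-1,1]^d$ is a measurable, everywhere positive function with $\mu$-integral $1$. Knothe–Rosenblatt map. For a continuous probability density $f$ on $[-1,1]^d$ put $\hat f_k(\boldsymbol x)=\int_{[-1,1]^{d-k}}f(\boldsymbol x,t_{k+1},\dots,t_d)\,\mathrm d\mu(t)$ for $\boldsymbol x\in[-1,1]^k$, $0\le k\le d$; for $1\le k\le d$ put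 $f_k(\boldsymbol x)=\hat f_k(\boldsymbol x)/\hat f_{k-1}(\boldsymbol x_{[k-1]})$ and $F_{f;k}(\boldsymbol x_{[k-1]},x_k)=\frac12\int_{-1}^{x_k}f_k(\boldsymbol x_{[k-1]},t)\,\mathrm dt$. The Knothe–Rosenblatt map $T=(T_k)_{k=1}^d$ from $f_\rho$ to $f_\pi$ is defined inductively by $T_k(\boldsymbol x_{[k-1]},\cdot)=F_{f_\pi;k}(T_1(x_1),\dots,T_{k-1}(\boldsymbol x_{[k-1]}),\cdot)^{-1}\circ F_{f_\rho;k}(\boldsymbol x_{[k-1]},\cdot)$, the inverse being that of a bijection $[-1,1]\to[0,1]$. Theorem. Let $0<M\le L<\infty$. There exist constants $C_6,C_7,C_8>0$ depending only on $M$ and $L$ such that the following holds for all $d\in\mathbb N$ and $\boldsymbol\delta\in(0,\infty)^d$. Let $f_\rho,f_\pi$ be probability densities on $[-1,1]^d$ such that each $f\in\{f_\rho,f_\pi\}$ extends to a function $f\in C^1(\mathcal B_{\boldsymbol\delta}([-1,1]);\mathbb C)$ with (i) $M\le|f(\boldsymbol x)|\le L$ for all $\boldsymbol x\in\mathcal B_{\boldsymbol\delta}([-1,1])$;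 (ii) $\sup_{\boldsymbol y\in\mathcal B_{\boldsymbol\delta}}|f(\boldsymbol x+\boldsymbol y)-f(\boldsymbol x)|\le C_6$ for all $\boldsymbol x\in[-1,1]^d$; (iii) $\sup_{\boldsymbol y\in\mathcal B_{\boldsymbol\delta_{[k]}}\times\{0\}^{d-k}}|f(\boldsymbol x+\boldsymbol y)-f(\boldsymbol x)|\le C_6\,\delta_{k+1}$ for all $\boldsymbol x\in[-1,1]^d$ and $k\in\{1,\dots,d-1\}$. Let $T$ be the Knothe–Rosenblatt map from $f_\rho$ to $f_\pi$, and set $\zeta_k=C_7\delta_k$. Then for every $k\in\{1,\dots,d\}$ the partial derivative $R_k=\partial_{x_k}T_k$ exists on $[-1,1]^k$ and has an extension, again denoted $R_k$, such that (a) $R_k\in C^1(\mathcal B_{\boldsymbol\zeta_{[k]}}([-1,1]);\mathcal B_{C_8}(1))$ and $\operatorname{Re}R_k(\boldsymbol x)\ge 1/C_8$ for all $\boldsymbol x\in\mathcal B_{\boldsymbol\zeta_{[k]}}([-1,1])$; (b) if $k\ge2$, then $R_k(\boldsymbol x)\in\mathcal B_{C_8/\max\{1,\delta_k\}}(1)$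 for all $\boldsymbol x\in\mathcal B_{\boldsymbol\zeta_{[k-1]}}([-1,1])\times[-1,1]$. -/

import Mathlib

open MeasureTheory Set

noncomputable section

namespace KnotheRosenblatt

/-- The cube `[-1,1]^ι` in `ℝ^ι`. -/
def cube (ι : Type*) : Set (ι → ℝ) := {x | ∀ i, x i ∈ Icc (-1 : ℝ) 1}

/-- The real interval `[-1,1]` as a subset of `ℂ`. -/
def complexInterval : Set ℂ := (fun t : ℝ => (t : ℂ)) '' Icc (-1 : ℝ) 1

/-- A real vector regarded as a complex vector. -/
def toComplex {ι : Type*} (x : ι → ℝ) : ι → ℂ := fun i => (x i : ℂ)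

/-- The product `×_i B_{δ_i}([-1,1])` of the open `δ_i`-neighbourhoods of `[-1,1]` in `ℂ`. -/
def polystrip {ι : Type*} (δ : ι → ℝ) : Set (ι → ℂ) :=
  {z | ∀ i, z i ∈ Metric.thickening (δ i) complexInterval}

/-- The normalized Lebesgue measure on `[-1,1]`. -/
def mu₁ : Measure ℝ := (2⁻¹ : ENNReal) • volume.restrict (Icc (-1 : ℝ) 1)

/-- The product of normalized Lebesgue measures on `[-1,1]^ι`. -/
def mu (ι : Type*) [Fintype ι] : Measure (ι → ℝ) := Measure.pi fun _ => mu₁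

/-- `f` is a positive probability density on `[-1,1]^d` with respect to `mu`.
Only the values of `f` on the cube matter. -/
structure IsProbDensity {d : ℕ} (f : (Fin d → ℝ) → ℝ) : Prop where
  measurable : Measurable fun x : cube (Fin d) => f x
  pos : ∀ x ∈ cube (Fin d), 0 < f x
  integral_eq_one : ∫ x, f x ∂(mu (Fin d)) = 1

/-- The marginal `x ↦ ∫_{[-1,1]^{d-k}} f(x, t_{k+1}, …, t_d) μ(dt)` in the first `k` variables. -/
def marginal {d : ℕ} (f : (Fin d → ℝ) → ℝ) (k : ℕ) (x : Fin k → ℝ) : ℝ :=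
  ∫ t : {i : Fin d // k ≤ i.val} → ℝ,
    f (fun i => if h : i.val < k then x ⟨i.val, h⟩ else t ⟨i, not_lt.mp h⟩)
    ∂(mu {i : Fin d // k ≤ i.val})

/-- The density of the variable with (0-based) index `k`, conditioned on the variables before it. -/
def condDensity {d : ℕ} (f : (Fin d → ℝ) → ℝ) (k : ℕ) (x : Fin (k + 1) → ℝ) : ℝ :=
  marginal f (k + 1) x / marginal f k (Fin.init x)

/-- The distribution function, in the variable with (0-based) index `k`, of the conditional
density given the previous variables `x`. -/
def condCDF {d : ℕ} (f : (Fin d → ℝ) → ℝ) (k : ℕ) (x : Fin k → ℝ) (s : ℝ) : ℝ :=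
  (1 / 2) * ∫ t in (-1 : ℝ)..s, condDensity f k (Fin.snoc (α := fun _ => ℝ) x t)

/-- The first `k` components of the Knothe–Rosenblatt map from the density `fρ` to the density
`fπ`, as functions of the first `k` variables. The last component is the inverse on `[-1,1]` of the
conditional distribution function of the target (at the previously computed components), applied
to the conditional distribution function of the reference. -/
def krMap {d : ℕ} (fρ fπ : (Fin d → ℝ) → ℝ) : (k : ℕ) → (Fin k → ℝ) → (Fin k → ℝ)
  | 0, _ => Fin.elim0
  | k + 1, x =>
    Fin.snoc (α := fun _ => ℝ) (krMap fρ fπ k (Fin.init x))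
      (Function.invFunOn (condCDF fπ k (krMap fρ fπ k (Fin.init x))) (Icc (-1 : ℝ) 1)
        (condCDF fρ k (Fin.init x) (x (Fin.last k))))

/-- The component with (0-based) index `k` of the Knothe–Rosenblatt map, a function of the first
`k + 1` variables. -/
def krComponent {d : ℕ} (fρ fπ : (Fin d → ℝ) → ℝ) (k : ℕ) (x : Fin (k + 1) → ℝ) : ℝ :=
  krMap fρ fπ (k + 1) x (Fin.last k)

/-- `f` is a positive probability density on `[-1,1]^d`, and `g` is a holomorphic extension of it
to the polystrip of radii `δ`, with modulus in `[M, L]` there and with small variation, as measured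
by `C`. -/
structure DensityAssumption {d : ℕ} (M L C : ℝ) (δ : Fin d → ℝ)
    (f : (Fin d → ℝ) → ℝ) (g : (Fin d → ℂ) → ℂ) : Prop where
  density : IsProbDensity f
  extends_f : ∀ x ∈ cube (Fin d), g (toComplex x) = (f x : ℂ)
  contDiffOn : ContDiffOn ℂ 1 g (polystrip δ)
  bounds : ∀ z ∈ polystrip δ, M ≤ ‖g z‖ ∧ ‖g z‖ ≤ L
  small : ∀ x ∈ cube (Fin d), ∀ y : Fin d → ℂ, (∀ i, ‖y i‖ < δ i) →
    ‖g (toComplex x + y) - g (toComplex x)‖ ≤ C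
  small_partial : ∀ x ∈ cube (Fin d), ∀ j : Fin d, 1 ≤ j.val → ∀ y : Fin d → ℂ,
    (∀ i, i < j → ‖y i‖ < δ i) → (∀ i, j ≤ i → y i = 0) →
    ‖g (toComplex x + y) - g (toComplex x)‖ ≤ C * δ j

end KnotheRosenblatt

end

/-!
The conditional densities of `fρ` and `fπ` are quotients of marginals, so they extend
holomorphically to complex values of all variables, and the small variation of the densities keeps
these extensions close to the positive reals. A holomorphic function on a convex set whose
derivative has real part bounded below is injective and quantitatively open. Hence the conditional
distribution functions remain invertible near `[-1,1]`, and the defining equation `F_π(T) = F_ρ`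
of the Knothe–Rosenblatt map can be solved for complex arguments; by the implicit function theorem
the solution is holomorphic, and its derivative is the quotient of the two conditional densities.

Conditioning on complex values of the variables before `k` gives the distribution function an
imaginary part on `[-1,1]`, and the bound `C₆ * δ k` on the variation in these variables makes it
small compared with `δ k`, so that the solution does not leave the strip of radius `δ k`. If `δ k`
is large, then the Cauchy estimate shows that the conditional densities vary by `O(1 / δ k)` only;
as their mean is `1`, their quotient is within `O(1 / δ k)` of `1`.
-/

noncomputable section

namespace KnotheRosenblatt

open Filter Topology Metric

/-! ### Integrals depending on a parameter -/

section ParametricIntegral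

lemma exists_eventually_forall_norm_le {E X G : Type*} [TopologicalSpace E] [TopologicalSpace X]
    [SeminormedAddCommGroup G] {U : Set E} (hU : IsOpen U) {K : Set X} (hK : IsCompact K)
    {Φ : E → X → G} (hΦ : ContinuousOn (Function.uncurry Φ) (U ×ˢ K)) {z₀ : E} (hz₀ : z₀ ∈ U) :
    ∃ B : ℝ, ∀ᶠ z in 𝓝 z₀, ∀ x ∈ K, ‖Φ z x‖ ≤ B := by
  obtain ⟨B, hB⟩ := hK.exists_bound_of_continuousOn (hΦ.uncurry_left z₀ hz₀)
  have hlocal : ∀ y ∈ K, ∀ᶠ p : E × X in 𝓝 (z₀, y), p.2 ∈ K → ‖Φ p.1 p.2‖ ≤ B + 1 := by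
    intro y hy
    have hlt : ∀ᶠ p in 𝓝[U ×ˢ K] (z₀, y), ‖Function.uncurry Φ p‖ < B + 1 :=
      (hΦ (z₀, y) ⟨hz₀, hy⟩).norm.eventually_lt_const ((hB y hy).trans_lt (lt_add_one B))
    filter_upwards [eventually_nhdsWithin_iff.1 hlt, continuousAt_fst.eventually_mem
      (hU.mem_nhds hz₀)] with p hp hpU hpK using (hp ⟨hpU, hpK⟩).le
  exact ⟨B + 1, (hK.eventually_forall_of_forall_eventually
    (P := fun z x => x ∈ K → ‖Φ z x‖ ≤ B + 1) hlocal).mono fun z hz x hx => hz x hx hx⟩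

variable {X F : Type*} [TopologicalSpace X] [T2Space X] [MeasurableSpace X]
  [OpensMeasurableSpace X] {K : Set X} [NormedAddCommGroup F] [NormedSpace ℝ F]

lemma continuousOn_setIntegral {E : Type*} [TopologicalSpace E] [FirstCountableTopology E]
    {U : Set E} (hU : IsOpen U) (hK : IsCompact K) (μ : Measure X) [IsFiniteMeasureOnCompacts μ]
    {Φ : E → X → F} (hΦ : ContinuousOn (Function.uncurry Φ) (U ×ˢ K)) :
    ContinuousOn (fun z => ∫ x in K, Φ z x ∂μ) U := by
  intro z₀ hz₀
  obtain ⟨B, hB⟩ := exists_eventually_forall_norm_le hU hK hΦ hz₀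
  have hx : ∀ᵐ x ∂μ.restrict K, x ∈ K := ae_restrict_mem hK.measurableSet
  have : Fact (μ K < ⊤) := ⟨hK.measure_lt_top⟩
  refine continuousWithinAt_of_dominated (bound := fun _ => B) ?_ ?_ (integrable_const _) ?_
  · filter_upwards [self_mem_nhdsWithin] with z hz using
      (hΦ.uncurry_left z hz).aestronglyMeasurable_of_isCompact hK hK.measurableSet
  · filter_upwards [mem_nhdsWithin_of_mem_nhds hB] with z hz using hx.mono hz
  · exact hx.mono fun x hx => hΦ.uncurry_right x hx z₀ hz₀

variable {𝕜 E V : Type*} [RCLike 𝕜] [NormedSpace 𝕜 F] [NormedAddCommGroup E] [NormedSpace 𝕜 E]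
  [NormedAddCommGroup V] [NormedSpace 𝕜 V] {U : Set E}

lemma hasFDerivAt_setIntegral (hU : IsOpen U) (hK : IsCompact K) (μ : Measure X)
    [IsFiniteMeasureOnCompacts μ] {Φ : E → X → F} {Φ' : E → X → E →L[𝕜] F}
    (hΦ : ContinuousOn (Function.uncurry Φ) (U ×ˢ K))
    (hΦ' : ContinuousOn (Function.uncurry Φ') (U ×ˢ K))
    (hd : ∀ z ∈ U, ∀ x ∈ K, HasFDerivAt (fun z => Φ z x) (Φ' z x) z) {z₀ : E} (hz₀ : z₀ ∈ U) :
    HasFDerivAt (fun z => ∫ x in K, Φ z x ∂μ) (∫ x in K, Φ' z₀ x ∂μ) z₀ := by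
  obtain ⟨B, hB⟩ := exists_eventually_forall_norm_le hU hK hΦ' hz₀
  have hx : ∀ᵐ x ∂μ.restrict K, x ∈ K := ae_restrict_mem hK.measurableSet
  have : Fact (μ K < ⊤) := ⟨hK.measure_lt_top⟩
  refine hasFDerivAt_integral_of_dominated_of_fderiv_le (bound := fun _ => B)
    (inter_mem (hU.mem_nhds hz₀) hB) ?_ ((hΦ.uncurry_left z₀ hz₀).integrableOn_compact hK)
    ((hΦ'.uncurry_left z₀ hz₀).aestronglyMeasurable_of_isCompact hK hK.measurableSet)
    (hx.mono fun x hx z hz => hz.2 x hx) (integrable_const _)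
    (hx.mono fun x hx z hz => hd z hz.1 x hx)
  filter_upwards [hU.mem_nhds hz₀] with z hz using
    (hΦ.uncurry_left z hz).aestronglyMeasurable_of_isCompact hK hK.measurableSet

lemma contDiffOn_one_setIntegral (hU : IsOpen U) (hK : IsCompact K) (μ : Measure X)
    [IsFiniteMeasureOnCompacts μ] {Φ : E → X → F} {Φ' : E → X → E →L[𝕜] F}
    (hΦ : ContinuousOn (Function.uncurry Φ) (U ×ˢ K))
    (hΦ' : ContinuousOn (Function.uncurry Φ') (U ×ˢ K))
    (hd : ∀ z ∈ U, ∀ x ∈ K, HasFDerivAt (fun z => Φ z x) (Φ' z x) z) :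
    ContDiffOn 𝕜 1 (fun z => ∫ x in K, Φ z x ∂μ) U := by
  rw [show (1 : WithTop ℕ∞) = 0 + 1 from (zero_add 1).symm,
    contDiffOn_succ_iff_hasFDerivWithinAt_of_uniqueDiffOn hU.uniqueDiffOn]
  exact ⟨fun h => by simp at h, fun z => ∫ x in K, Φ' z x ∂μ,
    contDiffOn_zero.2 (continuousOn_setIntegral hU hK μ hΦ'),
    fun z hz => (hasFDerivAt_setIntegral hU hK μ hΦ hΦ' hd hz).hasFDerivWithinAt⟩

lemma contDiffOn_one_setIntegral_comp_affine (hU : IsOpen U) (hK : IsCompact K) (μ : Measure X)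
    [IsFiniteMeasureOnCompacts μ] {W : Set V} (hW : IsOpen W) {φ : V → F} (hφ : ContDiffOn 𝕜 1 φ W)
    {A : X → E →L[𝕜] V} {b : X → V} (hA : Continuous A) (hb : Continuous b)
    (hmaps : ∀ z ∈ U, ∀ x ∈ K, A x z + b x ∈ W) :
    ContDiffOn 𝕜 1 (fun z => ∫ x in K, φ (A x z + b x) ∂μ) U := by
  have hcont : Continuous fun p : E × X => A p.2 p.1 + b p.2 := by fun_prop
  have hm : MapsTo (fun p : E × X => A p.2 p.1 + b p.2) (U ×ˢ K) W :=
    fun p hp => hmaps p.1 hp.1 p.2 hp.2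
  have hφ' := (hφ.continuousOn_fderiv_of_isOpen hW le_rfl).comp hcont.continuousOn hm
  refine contDiffOn_one_setIntegral hU hK μ (Φ' := fun z x => (fderiv 𝕜 φ (A x z + b x)).comp (A x))
    (hφ.continuousOn.comp hcont.continuousOn hm)
    (hφ'.clm_comp (hA.comp continuous_snd).continuousOn) fun z hz x hx => ?_
  have hd := ((hφ.differentiableOn one_ne_zero).differentiableAt
    (hW.mem_nhds (hmaps z hz x hx))).hasFDerivAt
  exact hd.comp z ((A x).hasFDerivAt.add_const (b x))

end ParametricIntegral

/-! ### Strips around the interval and primitives on them -/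

/-- The open `r`-neighbourhood of `[-1,1]` in `ℂ`. -/
abbrev strip (r : ℝ) : Set ℂ := thickening r complexInterval

lemma complexInterval_eq_segment : complexInterval = segment ℝ (-1 : ℂ) 1 := by
  have h := image_segment ℝ Complex.ofRealCLM.toLinearMap.toAffineMap (-1 : ℝ) 1
  rw [segment_eq_Icc (by norm_num)] at h
  simpa [complexInterval] using h

section Strip

variable {r : ℝ} {s : ℂ} {t : ℝ}

lemma isOpen_strip : IsOpen (strip r) := isOpen_thickening

lemma convex_strip : Convex ℝ (strip r) := by
  rw [strip, complexInterval_eq_segment]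
  exact (convex_segment _ _).thickening r

lemma mem_strip_iff : s ∈ strip r ↔ ∃ t ∈ Icc (-1 : ℝ) 1, ‖s - t‖ < r := by
  simp only [strip, mem_thickening_iff, complexInterval, exists_mem_image, dist_eq_norm]

lemma ofReal_mem_strip (hr : 0 < r) (ht : t ∈ Icc (-1 : ℝ) 1) : (t : ℂ) ∈ strip r :=
  mem_strip_iff.2 ⟨t, ht, by simpa using hr⟩

lemma neg_one_add_mul_mem_strip (hr : 0 < r) (hs : s ∈ strip r) (ht : t ∈ Icc (0 : ℝ) 1) :
    -1 + t * (s + 1) ∈ strip r := by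
  have hneg : (-1 : ℂ) ∈ strip r := by simpa using ofReal_mem_strip hr (t := -1) (by norm_num)
  simpa [mul_add] using convex_strip.add_smul_sub_mem hneg hs ht

end Strip

/-- Half of the primitive of `q` vanishing at `-1`, integrated along the segment from `-1` to `s`:
the extension to complex arguments of the distribution function of a density `q` with respect to
the normalized Lebesgue measure on `[-1,1]`. -/
def complexCDF (q : ℂ → ℂ) (s : ℂ) : ℂ :=
  1 / 2 * ((s + 1) * ∫ u in Icc (0 : ℝ) 1, q (-1 + u * (s + 1)))

section ComplexCDF

variable {r : ℝ} {q : ℂ → ℂ} {s : ℂ}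

@[simp] lemma complexCDF_neg_one (q : ℂ → ℂ) : complexCDF q (-1) = 0 := by
  simp [complexCDF]

lemma complexCDF_eq_of_hasDerivAt (hr : 0 < r) (hq : ContinuousOn q (strip r)) {Q : ℂ → ℂ}
    (hQ : ∀ s ∈ strip r, HasDerivAt Q (q s) s) (hs : s ∈ strip r) :
    complexCDF q s = 1 / 2 * (Q s - Q (-1)) := by
  have hmem : ∀ u ∈ uIcc (0 : ℝ) 1, -1 + u * (s + 1) ∈ strip r := fun u hu =>
    neg_one_add_mul_mem_strip hr hs (by rwa [uIcc_of_le zero_le_one] at hu)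
  have hderiv : ∀ u ∈ uIcc (0 : ℝ) 1, HasDerivAt (fun u : ℝ => Q (-1 + u * (s + 1)))
      ((s + 1) * q (-1 + u * (s + 1))) u := by
    intro u hu
    have hpath : HasDerivAt (fun u : ℝ => -1 + (u : ℂ) * (s + 1)) (s + 1) u := by
      simpa using ((Complex.ofRealCLM.hasDerivAt (x := u)).mul_const (s + 1)).const_add (-1)
    simpa [Function.comp_def, mul_comm] using (hQ _ (hmem u hu)).comp_of_eq (x := u)
      (h := fun u : ℝ => -1 + (u : ℂ) * (s + 1)) hpath rfl
  have hint := intervalIntegral.integral_eq_sub_of_hasDerivAt hderiv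
    (continuousOn_const.mul (hq.comp (by fun_prop) hmem)).intervalIntegrable
  rw [intervalIntegral.integral_const_mul, intervalIntegral.integral_of_le zero_le_one,
    ← integral_Icc_eq_integral_Ioc] at hint
  simp [complexCDF, hint]

lemma hasDerivAt_complexCDF (hr : 0 < r) (hq : DifferentiableOn ℂ q (strip r))
    (hs : s ∈ strip r) : HasDerivAt (complexCDF q) (q s / 2) s := by
  obtain ⟨Q, hQ⟩ := convex_strip.exists_forall_hasDerivWithinAt hq
  have hQ' : ∀ s ∈ strip r, HasDerivAt Q (q s) s := fun s hs =>
    (hQ s hs).hasDerivAt (isOpen_strip.mem_nhds hs)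
  have hderiv : HasDerivAt (fun s => 1 / 2 * (Q s - Q (-1))) (q s / 2) s := by
    simpa [div_eq_inv_mul] using ((hQ' s hs).sub_const (Q (-1))).const_mul (1 / 2 : ℂ)
  refine hderiv.congr_of_eventuallyEq ?_
  filter_upwards [isOpen_strip.mem_nhds hs] with w hw using
    complexCDF_eq_of_hasDerivAt hr hq.continuousOn hQ' hw

lemma complexCDF_ofReal (hr : 0 < r) (hq : DifferentiableOn ℂ q (strip r)) {t : ℝ}
    (ht : t ∈ Icc (-1 : ℝ) 1) : complexCDF q t = 1 / 2 * ∫ τ in (-1 : ℝ)..t, q τ := by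
  have hmem : ∀ τ ∈ uIcc (-1 : ℝ) t, (τ : ℂ) ∈ strip r := by
    intro τ hτ
    rw [uIcc_of_le ht.1] at hτ
    exact ofReal_mem_strip hr ⟨hτ.1, hτ.2.trans ht.2⟩
  have hint := intervalIntegral.integral_eq_sub_of_hasDerivAt
    (fun τ hτ => (hasDerivAt_complexCDF hr hq (hmem τ hτ)).comp_ofReal)
    ((hq.continuousOn.comp (by fun_prop) hmem).div_const 2).intervalIntegrable
  simp only [intervalIntegral.integral_div, Complex.ofReal_neg, Complex.ofReal_one,
    complexCDF_neg_one, sub_zero] at hint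
  rw [← hint]
  ring

lemma contDiffOn_complexCDF {E : Type*} [NormedAddCommGroup E] [NormedSpace ℂ E] {P : Set E}
    (hP : IsOpen P) (hr : 0 < r) {q : E → ℂ → ℂ}
    (hq : ContDiffOn ℂ 1 (fun p : E × ℂ => q p.1 p.2) (P ×ˢ strip r)) :
    ContDiffOn ℂ 1 (fun p : E × ℂ => complexCDF (q p.1) p.2) (P ×ˢ strip r) := by
  let A : ℝ → E × ℂ →L[ℂ] E × ℂ := fun u =>
    (ContinuousLinearMap.fst ℂ E ℂ).prod 0 +
      (u : ℂ) • (0 : E × ℂ →L[ℂ] E).prod (ContinuousLinearMap.snd ℂ E ℂ)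
  have hA : ∀ (u : ℝ) (p : E × ℂ), A u p + (0, (u : ℂ) - 1) = (p.1, -1 + u * (p.2 + 1)) := by
    intro u p
    ext
    · simp [A]
    · simp only [A, _root_.add_apply, _root_.smul_apply, ContinuousLinearMap.prod_apply,
        _root_.zero_apply, ContinuousLinearMap.coe_snd', Prod.snd_add, Prod.smul_snd,
        smul_eq_mul, zero_add]
      ring
  have hint := contDiffOn_one_setIntegral_comp_affine (hP.prod isOpen_strip)
    (isCompact_Icc (a := (0 : ℝ)) (b := 1)) volume (hP.prod isOpen_strip) hq (A := A)
    (b := fun u : ℝ => (0, (u : ℂ) - 1)) (by fun_prop) (by fun_prop)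
    fun p hp u hu => by
      rw [hA]
      exact ⟨hp.1, neg_one_add_mul_mem_strip hr hp.2 hu⟩
  simp only [hA] at hint
  exact contDiffOn_const.mul ((contDiff_snd.add contDiff_const).contDiffOn.mul hint)

end ComplexCDF

/-! ### Holomorphic functions whose derivative has positive real part -/

section PositiveRealPart

variable {m l : ℝ} {S : Set ℂ} {h h' : ℂ → ℂ}

/-- The center `l ^ 2 / m` is so large that the disc around it misses the origin; a function with
derivative in this disc is therefore a small perturbation of a dilation. -/
lemma norm_sub_ofReal_le_of_le_re (hm : 0 < m) {w : ℂ} (hw : ‖w‖ ≤ l) (hre : m ≤ w.re) :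
    ‖w - (l ^ 2 / m : ℝ)‖ ≤ l ^ 2 / m - m / 2 := by
  have hml : m ≤ l := hre.trans ((Complex.re_le_norm w).trans hw)
  have hsq : ‖w‖ ^ 2 ≤ l ^ 2 := by gcongr
  have hle : m ≤ l ^ 2 / m := by
    rw [le_div_iff₀ hm]
    nlinarith
  have hcancel : l ^ 2 / m * m = l ^ 2 := div_mul_cancel₀ _ hm.ne'
  refine abs_le_of_sq_le_sq' ?_ (by linarith) |>.2
  rw [← Complex.normSq_eq_norm_sq, Complex.normSq_apply] at hsq ⊢
  simp only [Complex.sub_re, Complex.ofReal_re, Complex.sub_im, Complex.ofReal_im, sub_zero]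
  nlinarith

lemma approximatesLinearOn_of_le_re_deriv (hm : 0 < m) (hS : Convex ℝ S)
    (hd : ∀ s ∈ S, HasDerivAt h (h' s) s) (hl : ∀ s ∈ S, ‖h' s‖ ≤ l)
    (hre : ∀ s ∈ S, m ≤ (h' s).re) :
    ApproximatesLinearOn h (((l ^ 2 / m : ℝ) : ℂ) • ContinuousLinearMap.id ℂ ℂ) S
      (l ^ 2 / m - m / 2).toNNReal := by
  intro x hx y hy
  have hle : 0 ≤ l ^ 2 / m - m / 2 :=
    (norm_nonneg _).trans (norm_sub_ofReal_le_of_le_re hm (hl x hx) (hre x hx))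
  have hlip := hS.norm_image_sub_le_of_norm_hasDerivWithin_le
    (f := fun s => h s - ((l ^ 2 / m : ℝ) : ℂ) * s)
    (fun s hs => ((hd s hs).sub ((hasDerivAt_id s).const_mul _)).hasDerivWithinAt)
    (fun s hs => by simpa using norm_sub_ofReal_le_of_le_re hm (hl s hs) (hre s hs)) hy hx
  rw [Real.coe_toNNReal _ hle]
  convert hlip using 2
  simp only [_root_.smul_apply, ContinuousLinearMap.id_apply, smul_eq_mul]
  ring

lemma mul_norm_sub_le_norm_sub_of_le_re_deriv (hm : 0 < m) (hS : Convex ℝ S)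
    (hd : ∀ s ∈ S, HasDerivAt h (h' s) s) (hl : ∀ s ∈ S, ‖h' s‖ ≤ l)
    (hre : ∀ s ∈ S, m ≤ (h' s).re) {x y : ℂ} (hx : x ∈ S) (hy : y ∈ S) :
    m / 2 * ‖x - y‖ ≤ ‖h x - h y‖ := by
  have ha : 0 ≤ l ^ 2 / m := by positivity
  have hle : 0 ≤ l ^ 2 / m - m / 2 :=
    (norm_nonneg _).trans (norm_sub_ofReal_le_of_le_re hm (hl x hx) (hre x hx))
  have happrox := approximatesLinearOn_of_le_re_deriv hm hS hd hl hre x hx y hy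
  have htri := norm_sub_norm_le (((l ^ 2 / m : ℝ) : ℂ) * (x - y)) (h x - h y)
  rw [norm_sub_rev (_ * _), norm_mul, Complex.norm_real, Real.norm_of_nonneg ha] at htri
  rw [Real.coe_toNNReal _ hle, _root_.smul_apply, ContinuousLinearMap.id_apply,
    smul_eq_mul] at happrox
  linarith

lemma surjOn_closedBall_of_le_re_deriv (hm : 0 < m) (hS : Convex ℝ S)
    (hd : ∀ s ∈ S, HasDerivAt h (h' s) s) (hl : ∀ s ∈ S, ‖h' s‖ ≤ l)
    (hre : ∀ s ∈ S, m ≤ (h' s).re) {s₀ : ℂ} {r : ℝ} (hr : 0 ≤ r) (hball : closedBall s₀ r ⊆ S) :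
    SurjOn h (closedBall s₀ r) (closedBall (h s₀) (m / 2 * r)) := by
  have hs₀ : s₀ ∈ S := hball (mem_closedBall_self hr)
  have hle : 0 ≤ l ^ 2 / m - m / 2 :=
    (norm_nonneg _).trans (norm_sub_ofReal_le_of_le_re hm (hl s₀ hs₀) (hre s₀ hs₀))
  have ha : 0 < l ^ 2 / m := by linarith
  let inv : (((l ^ 2 / m : ℝ) : ℂ) • ContinuousLinearMap.id ℂ ℂ).NonlinearRightInverse :=
    { toFun := fun y => ((l ^ 2 / m : ℝ) : ℂ)⁻¹ * y
      nnnorm := (l ^ 2 / m)⁻¹.toNNReal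
      bound' := fun y => by
        rw [norm_mul, norm_inv, Complex.norm_real, Real.norm_of_nonneg ha.le,
          Real.coe_toNNReal _ (inv_nonneg.2 ha.le)]
      right_inv' := fun y => mul_inv_cancel_left₀ (Complex.ofReal_ne_zero.2 ha.ne') y }
  have hsurj := (approximatesLinearOn_of_le_re_deriv hm hS hd hl hre)
    |>.surjOn_closedBall_of_nonlinearRightInverse inv hr hball
  rwa [Real.coe_toNNReal _ hle, Real.coe_toNNReal _ (inv_nonneg.2 ha.le), inv_inv,
    sub_sub_cancel] at hsurj

end PositiveRealPart

/-- Continuity of `τ` is not assumed: injectivity identifies `τ` with the implicit function near any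
point. -/
lemma contDiffOn_of_implicit {𝕜 E : Type*} [RCLike 𝕜] [NormedAddCommGroup E]
    [NormedSpace 𝕜 E] [CompleteSpace E] {U : Set E} (hU : IsOpen U) {S : Set 𝕜} (hS : IsOpen S)
    {Ψ : E × 𝕜 → 𝕜} {Ψ' : E → 𝕜 → 𝕜} (hΨ : ContDiffOn 𝕜 1 Ψ (U ×ˢ S))
    (hd : ∀ x ∈ U, ∀ s ∈ S, HasDerivAt (fun s => Ψ (x, s)) (Ψ' x s) s)
    (hne : ∀ x ∈ U, ∀ s ∈ S, Ψ' x s ≠ 0) (hinj : ∀ x ∈ U, InjOn (fun s => Ψ (x, s)) S)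
    {τ : E → 𝕜} (hτ : ∀ x ∈ U, τ x ∈ S) (hzero : ∀ x ∈ U, Ψ (x, τ x) = 0) :
    ContDiffOn 𝕜 1 τ U := by
  intro x₀ hx₀
  have hΨ₀ : ContDiffAt 𝕜 1 Ψ (x₀, τ x₀) :=
    hΨ.contDiffAt ((hU.prod hS).mem_nhds ⟨hx₀, hτ x₀ hx₀⟩)
  have hpartial : HasFDerivAt (fun s => Ψ (x₀, s))
      (fderiv 𝕜 Ψ (x₀, τ x₀) ∘L .inr 𝕜 E 𝕜) (τ x₀) :=
    (hΨ₀.differentiableAt one_ne_zero).hasFDerivAt.comp _ (hasFDerivAt_prodMk_right x₀ (τ x₀))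
  have hinv : (fderiv 𝕜 Ψ (x₀, τ x₀) ∘L .inr 𝕜 E 𝕜).IsInvertible := by
    refine ⟨ContinuousLinearEquiv.unitsEquivAut 𝕜
      (Units.mk0 _ (hne x₀ hx₀ _ (hτ x₀ hx₀))), ?_⟩
    rw [hpartial.unique (hd x₀ hx₀ _ (hτ x₀ hx₀)).hasFDerivAt]
    ext
    simp
  have hψ := hΨ₀.contDiffAt_implicitFunction one_ne_zero hinv
  have hself := hΨ₀.implicitFunction_apply_self one_ne_zero hinv
  have hsolves := hΨ₀.eventually_apply_implicitFunction one_ne_zero hinv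
  simp only at hψ hself hsolves
  have hmem : ∀ᶠ x in 𝓝 x₀, hΨ₀.implicitFunction one_ne_zero hinv x ∈ S :=
    hψ.continuousAt.eventually_mem (by simpa only [hself] using hS.mem_nhds (hτ x₀ hx₀))
  refine (hψ.congr_of_eventuallyEq ?_).contDiffWithinAt
  filter_upwards [hsolves, hmem, hU.mem_nhds hx₀] with x hx_solves hx_mem hx
  exact hinj x hx (hτ x hx) hx_mem (by simp only [hzero x hx, hx_solves, hzero x₀ hx₀])

/-! ### The cube and its uniform measure -/

section Cube

variable {ι : Type*}

lemma cube_eq_pi : cube ι = univ.pi fun _ => Icc (-1 : ℝ) 1 := by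
  ext x
  simp only [cube, mem_univ_pi]
  rfl

lemma isCompact_cube : IsCompact (cube ι) := by
  rw [cube_eq_pi]
  exact isCompact_univ_pi fun _ => isCompact_Icc

instance : IsProbabilityMeasure mu₁ := by
  refine ⟨?_⟩
  simp only [mu₁, Measure.smul_apply, Measure.restrict_apply_univ, Real.volume_Icc, smul_eq_mul]
  norm_num
  exact ENNReal.inv_mul_cancel (by norm_num) (by norm_num)

lemma ae_mem_Icc : ∀ᵐ t ∂mu₁, t ∈ Icc (-1 : ℝ) 1 :=
  Measure.ae_smul_measure (ae_restrict_mem measurableSet_Icc) _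

lemma integral_mu₁ {G : Type*} [NormedAddCommGroup G] [NormedSpace ℝ G] (φ : ℝ → G) :
    ∫ t, φ t ∂mu₁ = (1 / 2 : ℝ) • ∫ t in (-1 : ℝ)..1, φ t := by
  rw [mu₁, integral_smul_measure, intervalIntegral.integral_of_le (by norm_num),
    integral_Icc_eq_integral_Ioc]
  simp

variable [Fintype ι]

instance : IsProbabilityMeasure (mu ι) := by
  unfold mu
  infer_instance

lemma ae_mem_cube : ∀ᵐ t ∂mu ι, t ∈ cube ι := by
  simp only [cube, mem_ofPred_eq, eventually_all]
  exact fun i => (Measure.quasiMeasurePreserving_eval (μ := fun _ : ι => mu₁) i).ae ae_mem_Icc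

lemma restrict_mu_cube : (mu ι).restrict (cube ι) = mu ι :=
  Measure.restrict_eq_self_of_ae_mem ae_mem_cube

end Cube

/-! ### Transport between complex densities on the interval -/

/-- A holomorphic function `q` on the strip of radius `η` that behaves like a probability density
on `[-1,1]` with values in `[1/l, l]`: it is normalized, and its imaginary part is small. The
conditional densities at complex values of the conditioning variables have these properties. The
bound on the imaginary part over the real interval decides how far the transport of a real point can
leave the real interval. -/
structure IsComplexDensity (l η : ℝ) (q : ℂ → ℂ) : Prop where
  pos : 0 < η
  differentiableOn : DifferentiableOn ℂ q (strip η)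
  integral_eq_one : ∫ t : ℝ, q t ∂mu₁ = 1
  norm_le : ∀ s ∈ strip η, ‖q s‖ ≤ l
  inv_le_re : ∀ s ∈ strip η, l⁻¹ ≤ (q s).re
  abs_im_le : ∀ s ∈ strip η, |(q s).im| ≤ (2 * l)⁻¹
  abs_im_ofReal_le : ∀ t ∈ Icc (-1 : ℝ) 1, |(q t).im| ≤ min 1 η / (32 * l)

lemma closedBall_ofReal_subset_strip {r η t : ℝ} (hr : r < η) (ht : t ∈ Icc (-1 : ℝ) 1) :
    closedBall (t : ℂ) r ⊆ strip η := fun _ hs =>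
  mem_strip_iff.2 ⟨t, ht, (mem_closedBall_iff_norm.1 hs).trans_lt hr⟩

namespace IsComplexDensity

variable {l η : ℝ} {q : ℂ → ℂ}

lemma integrable (h : IsComplexDensity l η q) : Integrable (fun t : ℝ => q t) mu₁ := by
  by_contra hn
  exact zero_ne_one ((integral_undef hn).symm.trans h.integral_eq_one)

lemma one_le (h : IsComplexDensity l η q) : 1 ≤ l := by
  have hle := norm_integral_le_of_norm_le_const
    (ae_mem_Icc.mono fun t ht => h.norm_le t (ofReal_mem_strip h.pos ht))
  simpa [h.integral_eq_one] using hle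

lemma hasDerivAt_complexCDF (h : IsComplexDensity l η q) {s : ℂ} (hs : s ∈ strip η) :
    HasDerivAt (complexCDF q) (q s / 2) s :=
  KnotheRosenblatt.hasDerivAt_complexCDF h.pos h.differentiableOn hs

lemma complexCDF_one (h : IsComplexDensity l η q) : complexCDF q 1 = 1 := by
  have hone := complexCDF_ofReal h.pos h.differentiableOn (t := 1) (by norm_num)
  have hmu := integral_mu₁ fun t : ℝ => q t
  rw [h.integral_eq_one, Complex.real_smul] at hmu
  push_cast at hone hmu
  exact hone.trans hmu.symm

lemma norm_deriv_complexCDF_le (h : IsComplexDensity l η q) {s : ℂ} (hs : s ∈ strip η) :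
    ‖q s / 2‖ ≤ l / 2 := by
  rw [norm_div, Complex.norm_ofNat]
  gcongr
  exact h.norm_le s hs

lemma le_re_deriv_complexCDF (h : IsComplexDensity l η q) {s : ℂ} (hs : s ∈ strip η) :
    (2 * l)⁻¹ ≤ (q s / 2).re := by
  rw [Complex.div_ofNat_re, mul_inv, inv_mul_eq_div]
  gcongr
  exact h.inv_le_re s hs

lemma norm_complexCDF_sub_le (h : IsComplexDensity l η q) {x y : ℂ} (hx : x ∈ strip η)
    (hy : y ∈ strip η) : ‖complexCDF q x - complexCDF q y‖ ≤ l / 2 * ‖x - y‖ :=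
  convex_strip.norm_image_sub_le_of_norm_hasDerivWithin_le
    (fun _ hs => (h.hasDerivAt_complexCDF hs).hasDerivWithinAt)
    (fun _ hs => h.norm_deriv_complexCDF_le hs) hy hx

lemma norm_sub_le_norm_complexCDF_sub (h : IsComplexDensity l η q) {x y : ℂ} (hx : x ∈ strip η)
    (hy : y ∈ strip η) : ‖x - y‖ ≤ 4 * l * ‖complexCDF q x - complexCDF q y‖ := by
  have hl := h.one_le
  have hexp := mul_norm_sub_le_norm_sub_of_le_re_deriv (m := (2 * l)⁻¹) (by positivity)
    convex_strip (fun _ hs => h.hasDerivAt_complexCDF hs)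
    (fun _ hs => h.norm_deriv_complexCDF_le hs) (fun _ hs => h.le_re_deriv_complexCDF hs) hx hy
  calc ‖x - y‖ = 4 * l * ((2 * l)⁻¹ / 2 * ‖x - y‖) := by
        field_simp
        ring
    _ ≤ 4 * l * ‖complexCDF q x - complexCDF q y‖ := by gcongr

lemma injOn_complexCDF (h : IsComplexDensity l η q) : InjOn (complexCDF q) (strip η) := by
  intro x hx y hy hxy
  simpa [hxy, sub_eq_zero] using h.norm_sub_le_norm_complexCDF_sub hx hy

lemma surjOn_complexCDF (h : IsComplexDensity l η q) {s₀ : ℂ} {r : ℝ} (hr : 0 ≤ r)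
    (hball : closedBall s₀ r ⊆ strip η) :
    SurjOn (complexCDF q) (closedBall s₀ r) (closedBall (complexCDF q s₀) (r / (4 * l))) := by
  have hl := h.one_le
  have hsurj := surjOn_closedBall_of_le_re_deriv (m := (2 * l)⁻¹) (by positivity)
    (convex_strip (r := η)) (fun _ hs => h.hasDerivAt_complexCDF hs)
    (fun _ hs => h.norm_deriv_complexCDF_le hs) (fun _ hs => h.le_re_deriv_complexCDF hs) hr hball
  rwa [show (2 * l)⁻¹ / 2 * r = r / (4 * l) by field_simp; ring] at hsurj

lemma monotoneOn_re_complexCDF (h : IsComplexDensity l η q) :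
    MonotoneOn (fun t : ℝ => (complexCDF q t).re) (Icc (-1) 1) := by
  have hl := h.one_le
  have hderiv : ∀ t ∈ Icc (-1 : ℝ) 1,
      HasDerivAt (fun t : ℝ => (complexCDF q t).re) (q t / 2).re t := fun t ht =>
    (h.hasDerivAt_complexCDF (ofReal_mem_strip h.pos ht)).real_of_complex
  refine monotoneOn_of_hasDerivWithinAt_nonneg (convex_Icc _ _)
    (fun t ht => (hderiv t ht).continuousAt.continuousWithinAt)
    (fun t ht => (hderiv t (interior_subset ht)).hasDerivWithinAt) fun t ht => ?_
  have hpos : 0 ≤ (2 * l)⁻¹ := by positivity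
  exact hpos.trans (h.le_re_deriv_complexCDF (ofReal_mem_strip h.pos (interior_subset ht)))

lemma re_complexCDF_mem_Icc (h : IsComplexDensity l η q) {t : ℝ} (ht : t ∈ Icc (-1 : ℝ) 1) :
    (complexCDF q t).re ∈ Icc (0 : ℝ) 1 := by
  constructor
  · simpa using h.monotoneOn_re_complexCDF (left_mem_Icc.2 (by norm_num)) ht ht.1
  · simpa [h.complexCDF_one] using
      h.monotoneOn_re_complexCDF ht (right_mem_Icc.2 (by norm_num)) ht.2

lemma surjOn_re_complexCDF (h : IsComplexDensity l η q) :
    SurjOn (fun t : ℝ => (complexCDF q t).re) (Icc (-1) 1) (Icc 0 1) := by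
  have hcont : ContinuousOn (fun t : ℝ => (complexCDF q t).re) (Icc (-1) 1) := fun t ht =>
    (h.hasDerivAt_complexCDF (ofReal_mem_strip h.pos ht)).real_of_complex.continuousAt
      |>.continuousWithinAt
  simpa [SurjOn, h.complexCDF_one] using intermediate_value_Icc (by norm_num) hcont

lemma abs_im_complexCDF_le (h : IsComplexDensity l η q) {t : ℝ} (ht : t ∈ Icc (-1 : ℝ) 1) :
    |(complexCDF q t).im| ≤ min 1 η / (32 * l) := by
  have hl := h.one_le
  have hη := h.pos
  have hderiv : ∀ τ ∈ Icc (-1 : ℝ) 1, HasDerivWithinAt (fun τ : ℝ => (complexCDF q τ).im)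
      (q τ / 2).im (Icc (-1) 1) τ := fun τ hτ =>
    Complex.imCLM.hasFDerivAt.comp_hasDerivAt τ
      (h.hasDerivAt_complexCDF (ofReal_mem_strip hη hτ)).comp_ofReal |>.hasDerivWithinAt
  have hmean := (convex_Icc (-1 : ℝ) 1).norm_image_sub_le_of_norm_hasDerivWithin_le hderiv
    (C := min 1 η / (32 * l) / 2) (fun τ hτ => by
      rw [Complex.div_ofNat_im, norm_div, Real.norm_ofNat, Real.norm_eq_abs]
      gcongr
      exact h.abs_im_ofReal_le τ hτ) (left_mem_Icc.2 (by norm_num)) ht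
  have hlen : ‖t - -1‖ ≤ 2 := by
    rw [Real.norm_of_nonneg (by linarith [ht.1])]
    linarith [ht.2]
  calc |(complexCDF q t).im| ≤ min 1 η / (32 * l) / 2 * ‖t - -1‖ := by simpa using hmean
    _ ≤ min 1 η / (32 * l) / 2 * 2 := by gcongr
    _ = min 1 η / (32 * l) := div_mul_cancel₀ _ two_ne_zero

variable {q₁ q₂ : ℂ → ℂ} {t : ℝ}

lemma exists_norm_complexCDF_sub_le (h₁ : IsComplexDensity l η q₁) (h₂ : IsComplexDensity l η q₂)
    (ht : t ∈ Icc (-1 : ℝ) 1) : ∃ t' ∈ Icc (-1 : ℝ) 1,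
      ‖complexCDF q₁ t - complexCDF q₂ t'‖ ≤ min 1 η / (16 * l) := by
  obtain ⟨t', ht', hre⟩ := h₂.surjOn_re_complexCDF (h₁.re_complexCDF_mem_Icc ht)
  refine ⟨t', ht', ?_⟩
  have hre' : (complexCDF q₁ t - complexCDF q₂ t').re = 0 := by
    rw [Complex.sub_re, sub_eq_zero]
    exact hre.symm
  rw [← Complex.abs_im_eq_norm.2 hre', Complex.sub_im]
  calc |(complexCDF q₁ t).im - (complexCDF q₂ t').im|
      ≤ |(complexCDF q₁ t).im| + |(complexCDF q₂ t').im| := abs_sub _ _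
    _ ≤ min 1 η / (32 * l) + min 1 η / (32 * l) :=
        add_le_add (h₁.abs_im_complexCDF_le ht) (h₂.abs_im_complexCDF_le ht')
    _ = min 1 η / (16 * l) := by ring

end IsComplexDensity

/-- The monotone transport from `q₁` to `q₂`, extended to complex arguments: the solution `σ` in
the strip of radius `η` of `complexCDF q₂ σ = complexCDF q₁ s`. It exists if `q₁` and `q₂` are
complex densities and `s` lies in a strip of smaller radius. -/
def transport (η : ℝ) (q₁ q₂ : ℂ → ℂ) (s : ℂ) : ℂ :=
  Function.invFunOn (complexCDF q₂) (strip η) (complexCDF q₁ s)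

namespace IsComplexDensity

variable {l η : ℝ} {q q₁ q₂ : ℂ → ℂ} {s : ℂ} {t : ℝ}

lemma strip_subset (h : IsComplexDensity l η q) : strip (η / (8 * l ^ 2)) ⊆ strip η := by
  have hl := h.one_le
  exact thickening_mono (div_le_self h.pos.le (by nlinarith)) _

lemma complexCDF_mem_image (h₁ : IsComplexDensity l η q₁) (h₂ : IsComplexDensity l η q₂)
    (hs : s ∈ strip (η / (8 * l ^ 2))) : complexCDF q₁ s ∈ complexCDF q₂ '' strip η := by
  have hl := h₁.one_le
  have hη := h₁.pos
  obtain ⟨t, ht, hst⟩ := mem_strip_iff.1 hs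
  obtain ⟨t', ht', hCDF⟩ := exists_norm_complexCDF_sub_le h₁ h₂ ht
  have hball := closedBall_ofReal_subset_strip (half_lt_self hη) ht'
  refine image_mono hball (h₂.surjOn_complexCDF (by positivity) hball ?_)
  rw [mem_closedBall_iff_norm]
  calc ‖complexCDF q₁ s - complexCDF q₂ t'‖
      ≤ ‖complexCDF q₁ s - complexCDF q₁ t‖ + ‖complexCDF q₁ t - complexCDF q₂ t'‖ :=
        norm_sub_le_norm_sub_add_norm_sub _ _ _
    _ ≤ l / 2 * (η / (8 * l ^ 2)) + min 1 η / (16 * l) := by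
        gcongr
        exact (h₁.norm_complexCDF_sub_le (h₁.strip_subset hs) (ofReal_mem_strip hη ht)).trans
          (by gcongr)
    _ ≤ l / 2 * (η / (8 * l ^ 2)) + η / (16 * l) := by
        gcongr
        exact min_le_right _ _
    _ = η / 2 / (4 * l) := by
        field_simp
        ring

lemma transport_mem (h₁ : IsComplexDensity l η q₁) (h₂ : IsComplexDensity l η q₂)
    (hs : s ∈ strip (η / (8 * l ^ 2))) : transport η q₁ q₂ s ∈ strip η :=
  Function.invFunOn_mem (complexCDF_mem_image h₁ h₂ hs)

lemma complexCDF_transport (h₁ : IsComplexDensity l η q₁) (h₂ : IsComplexDensity l η q₂)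
    (hs : s ∈ strip (η / (8 * l ^ 2))) : complexCDF q₂ (transport η q₁ q₂ s) = complexCDF q₁ s :=
  Function.invFunOn_eq (complexCDF_mem_image h₁ h₂ hs)

lemma transport_eq (h₂ : IsComplexDensity l η q₂) {σ : ℂ} (hσ : σ ∈ strip η)
    (hCDF : complexCDF q₂ σ = complexCDF q₁ s) : transport η q₁ q₂ s = σ :=
  h₂.injOn_complexCDF (Function.invFunOn_mem ⟨σ, hσ, hCDF⟩) hσ
    ((Function.invFunOn_eq ⟨σ, hσ, hCDF⟩).trans hCDF.symm)

lemma ofReal_mem_strip_div (h : IsComplexDensity l η q) (ht : t ∈ Icc (-1 : ℝ) 1) :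
    (t : ℂ) ∈ strip (η / (8 * l ^ 2)) := by
  have hη := h.pos
  have hl := h.one_le
  exact ofReal_mem_strip (by positivity) ht

lemma exists_norm_transport_ofReal_sub_le (h₁ : IsComplexDensity l η q₁)
    (h₂ : IsComplexDensity l η q₂) (ht : t ∈ Icc (-1 : ℝ) 1) :
    ∃ t' ∈ Icc (-1 : ℝ) 1, ‖transport η q₁ q₂ t - t'‖ ≤ min 1 η / 4 := by
  have hl := h₁.one_le
  obtain ⟨t', ht', hCDF⟩ := exists_norm_complexCDF_sub_le h₁ h₂ ht
  refine ⟨t', ht', ?_⟩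
  have hs := h₁.ofReal_mem_strip_div ht
  calc ‖transport η q₁ q₂ t - t'‖
      ≤ 4 * l * ‖complexCDF q₂ (transport η q₁ q₂ t) - complexCDF q₂ t'‖ :=
        h₂.norm_sub_le_norm_complexCDF_sub (transport_mem h₁ h₂ hs) (ofReal_mem_strip h₁.pos ht')
    _ ≤ 4 * l * (min 1 η / (16 * l)) := by
        rw [complexCDF_transport h₁ h₂ hs]
        gcongr
    _ = min 1 η / 4 := by
        field_simp
        ring

lemma ne_zero (h : IsComplexDensity l η q) (hs : s ∈ strip η) : q s ≠ 0 := by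
  have hl := h.one_le
  intro h0
  have hre := h.inv_le_re s hs
  rw [h0, Complex.zero_re] at hre
  exact absurd hre (not_le.2 (by positivity))

lemma inv_le_norm (h : IsComplexDensity l η q) (hs : s ∈ strip η) : l⁻¹ ≤ ‖q s‖ :=
  (h.inv_le_re s hs).trans (Complex.re_le_norm _)

section Ratio

variable {σ : ℂ}

lemma norm_div_sub_one_le (h₂ : IsComplexDensity l η q₂) (hσ : σ ∈ strip η) :
    ‖q₁ s / q₂ σ - 1‖ ≤ l * ‖q₁ s - q₂ σ‖ := by
  have hl := h₂.one_le
  rw [div_sub_one (h₂.ne_zero hσ), norm_div, div_eq_inv_mul]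
  gcongr
  exact inv_le_of_inv_le₀ (by positivity) (h₂.inv_le_norm hσ)

lemma norm_div_sub_one_lt (h₁ : IsComplexDensity l η q₁) (h₂ : IsComplexDensity l η q₂)
    (hs : s ∈ strip η) (hσ : σ ∈ strip η) : ‖q₁ s / q₂ σ - 1‖ < 25 * l ^ 4 := by
  have hl := h₁.one_le
  calc ‖q₁ s / q₂ σ - 1‖ ≤ l * ‖q₁ s - q₂ σ‖ := h₂.norm_div_sub_one_le hσ
    _ ≤ l * (l + l) := by
        gcongr
        exact (norm_sub_le _ _).trans (add_le_add (h₁.norm_le s hs) (h₂.norm_le σ hσ))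
    _ = 2 * l ^ 2 := by ring
    _ ≤ 2 * l ^ 4 := by
        gcongr
        norm_num
    _ < 25 * l ^ 4 := by
        gcongr
        norm_num

lemma inv_le_re_div (h₁ : IsComplexDensity l η q₁) (h₂ : IsComplexDensity l η q₂)
    (hs : s ∈ strip η) (hσ : σ ∈ strip η) : 1 / (25 * l ^ 4) ≤ (q₁ s / q₂ σ).re := by
  have hl := h₁.one_le
  have him : -((2 * l)⁻¹ * (2 * l)⁻¹) ≤ (q₁ s).im * (q₂ σ).im := by
    refine neg_le_of_abs_le ?_
    rw [abs_mul]
    gcongr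
    exacts [h₁.abs_im_le s hs, h₂.abs_im_le σ hσ]
  have hre : l⁻¹ * l⁻¹ ≤ (q₁ s).re * (q₂ σ).re := by
    gcongr
    · exact (inv_nonneg.2 (by positivity)).trans (h₁.inv_le_re s hs)
    exacts [h₁.inv_le_re s hs, h₂.inv_le_re σ hσ]
  have hpos : 0 < Complex.normSq (q₂ σ) := Complex.normSq_pos.2 (h₂.ne_zero hσ)
  have hnorm : Complex.normSq (q₂ σ) ≤ l ^ 2 := by
    rw [Complex.normSq_eq_norm_sq]
    gcongr
    exact h₂.norm_le σ hσ
  calc 1 / (25 * l ^ 4) ≤ (l⁻¹ * l⁻¹ - (2 * l)⁻¹ * (2 * l)⁻¹) / l ^ 2 := by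
        field_simp
        norm_num
    _ ≤ (l⁻¹ * l⁻¹ - (2 * l)⁻¹ * (2 * l)⁻¹) / Complex.normSq (q₂ σ) := by
        gcongr
        rw [sub_nonneg]
        gcongr <;> linarith
    _ ≤ ((q₁ s).re * (q₂ σ).re + (q₁ s).im * (q₂ σ).im) / Complex.normSq (q₂ σ) := by
        gcongr
        linarith
    _ = (q₁ s / q₂ σ).re := by rw [Complex.div_re, add_div]

lemma norm_deriv_le (h : IsComplexDensity l η q) (hs : s ∈ strip (3 * η / 4)) :
    ‖deriv q s‖ ≤ 4 * l / η := by
  have hη := h.pos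
  obtain ⟨t, ht, hst⟩ := mem_strip_iff.1 hs
  have hsub : closedBall s (η / 4) ⊆ strip η := fun w hw => mem_strip_iff.2 ⟨t, ht, by
    have htri := norm_sub_le_norm_sub_add_norm_sub w s t
    linarith [mem_closedBall_iff_norm.1 hw]⟩
  have hcauchy := Complex.norm_deriv_le_of_forall_mem_sphere_norm_le (by positivity)
    (h.differentiableOn.diffContOnCl_ball hsub)
    fun w hw => h.norm_le w (hsub (sphere_subset_closedBall hw))
  exact hcauchy.trans_eq (by field_simp)

lemma norm_sub_le_mul_norm_sub (h : IsComplexDensity l η q) {x y : ℂ} (hx : x ∈ strip (3 * η / 4))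
    (hy : y ∈ strip (3 * η / 4)) : ‖q x - q y‖ ≤ 4 * l / η * ‖x - y‖ := by
  have hη := h.pos
  have hsub : strip (3 * η / 4) ⊆ strip η := thickening_mono (by linarith) _
  exact convex_strip.norm_image_sub_le_of_norm_deriv_le
    (fun w hw => h.differentiableOn.differentiableAt (isOpen_strip.mem_nhds (hsub hw)))
    (fun w hw => h.norm_deriv_le hw) hy hx

/-- On average over `[-1,1]` the density is equal to `1`, and it varies slowly if `η` is large. -/
lemma norm_sub_one_le (h : IsComplexDensity l η q) (ht : t ∈ Icc (-1 : ℝ) 1)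
    (hst : ‖s - t‖ ≤ min 1 η / 2) : ‖q s - 1‖ ≤ 12 * l / η := by
  have hη := h.pos
  have hl := h.one_le
  have hs : s ∈ strip (3 * η / 4) := mem_strip_iff.2 ⟨t, ht, by linarith [min_le_right 1 η]⟩
  have hdist : ∀ τ ∈ Icc (-1 : ℝ) 1, ‖s - τ‖ ≤ 3 := by
    intro τ hτ
    have htri := norm_sub_le_norm_sub_add_norm_sub s t τ
    have hreal : ‖(t : ℂ) - τ‖ ≤ 2 := by
      rw [← Complex.ofReal_sub, Complex.norm_real, Real.norm_eq_abs, abs_le]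
      constructor <;> linarith [ht.1, ht.2, hτ.1, hτ.2]
    linarith [min_le_left 1 η]
  have havg : q s - 1 = ∫ τ : ℝ, (q s - q τ) ∂mu₁ := by
    rw [integral_sub (integrable_const _) h.integrable, h.integral_eq_one]
    simp
  have hle := norm_integral_le_of_norm_le_const (f := fun τ : ℝ => q s - q τ) (μ := mu₁)
    (C := 4 * l / η * 3) <| ae_mem_Icc.mono fun τ hτ =>
      (h.norm_sub_le_mul_norm_sub hs (ofReal_mem_strip (by positivity) hτ)).trans
        (by gcongr; exact hdist τ hτ)
  rw [havg]
  calc ‖∫ τ : ℝ, (q s - q τ) ∂mu₁‖ ≤ 4 * l / η * 3 := by simpa using hle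
    _ = 12 * l / η := by ring

lemma norm_transport_div_sub_one_lt (h₁ : IsComplexDensity l η q₁)
    (h₂ : IsComplexDensity l η q₂) (ht : t ∈ Icc (-1 : ℝ) 1) :
    ‖q₁ t / q₂ (transport η q₁ q₂ t) - 1‖ < 25 * l ^ 4 / max 1 η := by
  have hη := h₁.pos
  have hl := h₁.one_le
  have hmem := transport_mem h₁ h₂ (h₁.ofReal_mem_strip_div ht)
  obtain ⟨t', ht', hnear⟩ := exists_norm_transport_ofReal_sub_le h₁ h₂ ht
  have hmin : 0 < min 1 η := lt_min one_pos hη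
  rcases le_total η 1 with h1 | h1
  · rw [max_eq_left h1, div_one]
    exact norm_div_sub_one_lt h₁ h₂ (ofReal_mem_strip hη ht) hmem
  rw [max_eq_right h1]
  have hone₁ : ‖q₁ t - 1‖ ≤ 12 * l / η := h₁.norm_sub_one_le ht (by simpa using (half_pos hmin).le)
  have hone₂ := h₂.norm_sub_one_le ht' (hnear.trans (by linarith))
  calc ‖q₁ t / q₂ (transport η q₁ q₂ t) - 1‖
      ≤ l * ‖q₁ t - q₂ (transport η q₁ q₂ t)‖ := h₂.norm_div_sub_one_le hmem
    _ ≤ l * (12 * l / η + 12 * l / η) := by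
        gcongr
        rw [norm_sub_rev] at hone₂
        exact (norm_sub_le_norm_sub_add_norm_sub _ 1 _).trans (add_le_add hone₁ hone₂)
    _ = 24 * l ^ 2 / η := by ring
    _ ≤ 24 * l ^ 4 / η := by
        gcongr
        norm_num
    _ < 25 * l ^ 4 / η := by
        gcongr
        norm_num

end Ratio

end IsComplexDensity

section ContDiff

variable {l η : ℝ} {E : Type*} [NormedAddCommGroup E] [NormedSpace ℂ E] [CompleteSpace E]
  {U : Set E}

lemma contDiffOn_transport (hU : IsOpen U) (hη : 0 < η) {q₁ q₂ : E → ℂ → ℂ}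
    (h₁ : ∀ x ∈ U, IsComplexDensity l η (q₁ x)) (h₂ : ∀ x ∈ U, IsComplexDensity l η (q₂ x))
    (hq₁ : ContDiffOn ℂ 1 (fun p : E × ℂ => q₁ p.1 p.2) (U ×ˢ strip η))
    (hq₂ : ContDiffOn ℂ 1 (fun p : E × ℂ => q₂ p.1 p.2) (U ×ˢ strip η))
    {a : E → ℂ} (ha : ContDiffOn ℂ 1 a U) (ha_mem : MapsTo a U (strip (η / (8 * l ^ 2)))) :
    ContDiffOn ℂ 1 (fun x => transport η (q₁ x) (q₂ x) (a x)) U := by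
  have hCDF₁ : ContDiffOn ℂ 1 (fun p : E × ℂ => complexCDF (q₁ p.1) (a p.1)) (U ×ˢ strip η) :=
    (contDiffOn_complexCDF hU hη hq₁).comp
      (contDiffOn_fst.prodMk (ha.comp contDiffOn_fst fun p hp => hp.1))
      fun p hp => ⟨hp.1, (h₁ p.1 hp.1).strip_subset (ha_mem hp.1)⟩
  exact contDiffOn_of_implicit hU isOpen_strip
    ((contDiffOn_complexCDF hU hη hq₂).sub hCDF₁) (Ψ' := fun x σ => q₂ x σ / 2)
    (fun x hx σ hσ => ((h₂ x hx).hasDerivAt_complexCDF hσ).sub_const (complexCDF (q₁ x) (a x)))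
    (fun x hx σ hσ => div_ne_zero ((h₂ x hx).ne_zero hσ) two_ne_zero)
    (fun x hx σ hσ σ' hσ' h => (h₂ x hx).injOn_complexCDF hσ hσ' (sub_left_injective h))
    (fun x hx => (h₁ x hx).transport_mem (h₂ x hx) (ha_mem hx))
    fun x hx => sub_eq_zero.2 ((h₁ x hx).complexCDF_transport (h₂ x hx) (ha_mem hx))

lemma IsComplexDensity.hasDerivAt_transport {q₁ q₂ : ℂ → ℂ} (h₁ : IsComplexDensity l η q₁)
    (h₂ : IsComplexDensity l η q₂) {s : ℂ} (hs : s ∈ strip (η / (8 * l ^ 2))) :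
    HasDerivAt (transport η q₁ q₂) (q₁ s / q₂ (transport η q₁ q₂ s)) s := by
  have hcont : ∀ {q : ℂ → ℂ}, IsComplexDensity l η q →
      ContDiffOn ℂ 1 (fun p : ℂ × ℂ => q p.2) (strip (η / (8 * l ^ 2)) ×ˢ strip η) := fun h =>
    (h.differentiableOn.contDiffOn isOpen_strip).comp contDiffOn_snd fun p hp => hp.2
  have hdiff : DifferentiableAt ℂ (transport η q₁ q₂) s :=
    ((contDiffOn_transport isOpen_strip h₁.pos (fun _ _ => h₁) (fun _ _ => h₂) (hcont h₁)
      (hcont h₂) contDiffOn_id (mapsTo_id _)).differentiableOn one_ne_zero).differentiableAt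
      (isOpen_strip.mem_nhds hs)
  have hmem := transport_mem h₁ h₂ hs
  have hchain := (h₂.hasDerivAt_complexCDF hmem).comp s hdiff.hasDerivAt
  have heq : complexCDF q₂ ∘ transport η q₁ q₂ =ᶠ[𝓝 s] complexCDF q₁ := by
    filter_upwards [isOpen_strip.mem_nhds hs] with w hw using complexCDF_transport h₁ h₂ hw
  have hunique := (hchain.congr_of_eventuallyEq heq.symm).unique
    (h₁.hasDerivAt_complexCDF (h₁.strip_subset hs))
  have hderiv : deriv (transport η q₁ q₂) s = q₁ s / q₂ (transport η q₁ q₂ s) := by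
    rw [eq_div_iff (h₂.ne_zero hmem)]
    linear_combination 2 * hunique
  exact hderiv ▸ hdiff.hasDerivAt

end ContDiff

/-! ### Points of cubes and polystrips -/

section Polystrip

variable {ι : Type*} {δ : ι → ℝ} {z : ι → ℂ} {x : ι → ℝ}

lemma isOpen_polystrip [Finite ι] : IsOpen (polystrip δ) := by
  have hpi : polystrip δ = univ.pi fun i => strip (δ i) := by
    ext
    simp [polystrip]
  rw [hpi]
  exact isOpen_set_pi finite_univ fun i _ => isOpen_strip

lemma exists_cube_of_mem_polystrip (hz : z ∈ polystrip δ) :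
    ∃ x ∈ cube ι, ∀ i, ‖z i - x i‖ < δ i := by
  choose x hx hxz using fun i => mem_strip_iff.1 (hz i)
  exact ⟨x, hx, hxz⟩

lemma toComplex_mem_polystrip (hδ : ∀ i, 0 < δ i) (hx : x ∈ cube ι) :
    toComplex x ∈ polystrip δ :=
  fun i => ofReal_mem_strip (hδ i) (hx i)

end Polystrip

section Tuple

variable {d k : ℕ} {δ : Fin d → ℝ}

lemma snoc_mem_cube {x : Fin k → ℝ} (hx : x ∈ cube (Fin k)) {t : ℝ} (ht : t ∈ Icc (-1 : ℝ) 1) :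
    (Fin.snoc (α := fun _ => ℝ) x t : Fin (k + 1) → ℝ) ∈ cube (Fin (k + 1)) := by
  refine Fin.lastCases ?_ fun i => ?_
  · simpa using ht
  · simpa using hx i

lemma toComplex_snoc (x : Fin k → ℝ) (t : ℝ) :
    toComplex (Fin.snoc (α := fun _ => ℝ) x t : Fin (k + 1) → ℝ) =
      Fin.snoc (α := fun _ => ℂ) (toComplex x) (t : ℂ) := by
  ext i
  refine Fin.lastCases ?_ (fun j => ?_) i <;> simp [toComplex]

lemma snoc_mem_polystrip_take (hk : k < d) {z : Fin k → ℂ}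
    (hz : z ∈ polystrip (Fin.take k hk.le δ)) {s : ℂ} (hs : s ∈ strip (δ ⟨k, hk⟩)) :
    (Fin.snoc (α := fun _ => ℂ) z s : Fin (k + 1) → ℂ) ∈ polystrip (Fin.take (k + 1) hk δ) := by
  refine Fin.lastCases ?_ fun i => ?_
  · rw [Fin.snoc_last]
    exact hs
  · rw [Fin.snoc_castSucc]
    exact hz i

lemma contDiff_snoc : ContDiff ℂ 1
    fun p : (Fin k → ℂ) × ℂ => (Fin.snoc (α := fun _ => ℂ) p.1 p.2 : Fin (k + 1) → ℂ) := by
  refine contDiff_pi.2 (Fin.lastCases ?_ fun i => ?_)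
  · simpa using contDiff_snd
  · simp only [Fin.snoc_castSucc]
    fun_prop

end Tuple

/-! ### Complex marginals -/

/-- The vector with first entries `x` and remaining entries `t`. -/
def merge {α : Type*} {d k : ℕ} (x : Fin k → α) (t : {i : Fin d // k ≤ i.val} → α) : Fin d → α :=
  fun i => if h : i.val < k then x ⟨i.val, h⟩ else t ⟨i, not_lt.mp h⟩

/-- The extension of `marginal` to complex arguments. -/
def complexMarginal {d : ℕ} (g : (Fin d → ℂ) → ℂ) (k : ℕ) (z : Fin k → ℂ) : ℂ :=
  ∫ t, g (merge z (toComplex t)) ∂mu {i : Fin d // k ≤ i.val}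

section Merge

variable {d k : ℕ} {δ : Fin d → ℝ}

lemma merge_mem_cube {x : Fin k → ℝ} {t : {i : Fin d // k ≤ i.val} → ℝ}
    (hx : x ∈ cube _) (ht : t ∈ cube _) : merge x t ∈ cube (Fin d) := by
  intro i
  unfold merge
  split_ifs
  exacts [hx _, ht _]

lemma toComplex_merge (x : Fin k → ℝ) (t : {i : Fin d // k ≤ i.val} → ℝ) :
    toComplex (merge x t) = merge (toComplex x) (toComplex t) := by
  ext i
  by_cases h : i.val < k <;> simp [merge, toComplex, h]

lemma merge_mem_polystrip (hδ : ∀ i, 0 < δ i) (hk : k ≤ d) {z : Fin k → ℂ}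
    (hz : z ∈ polystrip (Fin.take k hk δ)) {t : {i : Fin d // k ≤ i.val} → ℝ} (ht : t ∈ cube _) :
    merge z (toComplex t) ∈ polystrip δ := by
  intro i
  unfold merge
  split_ifs with h
  · exact hz ⟨i, h⟩
  · exact ofReal_mem_strip (hδ i) (ht _)

lemma continuous_merge_toComplex (z : Fin k → ℂ) :
    Continuous fun t : {i : Fin d // k ≤ i.val} → ℝ => (merge z (toComplex t) : Fin d → ℂ) := by
  refine continuous_pi fun i => ?_
  by_cases h : i.val < k
  · simpa only [merge, h, dite_true] using continuous_const
  · simp only [merge, h, toComplex, dite_false]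
    fun_prop

lemma merge_eq_pi_add (z : Fin k → ℂ) (t : {i : Fin d // k ≤ i.val} → ℂ) :
    merge z t = ContinuousLinearMap.pi (R := ℂ) (fun i : Fin d => if h : i.val < k then
      ContinuousLinearMap.proj (R := ℂ) (φ := fun _ : Fin k => ℂ) ⟨i.val, h⟩ else 0) z +
      merge 0 t := by
  ext i
  by_cases h : i.val < k <;> simp [merge, h]

end Merge

section Marginal

variable {d k : ℕ} {δ : Fin d → ℝ} {f : (Fin d → ℝ) → ℝ} {g : (Fin d → ℂ) → ℂ}

lemma contDiffOn_complexMarginal (hδ : ∀ i, 0 < δ i) (hg : ContDiffOn ℂ 1 g (polystrip δ))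
    (hk : k ≤ d) : ContDiffOn ℂ 1 (complexMarginal g k) (polystrip (Fin.take k hk δ)) := by
  have hint := contDiffOn_one_setIntegral_comp_affine (isOpen_polystrip (δ := Fin.take k hk δ))
    isCompact_cube (mu {i : Fin d // k ≤ i.val}) isOpen_polystrip hg continuous_const
    (continuous_merge_toComplex 0) fun z hz t ht => by
      rw [← merge_eq_pi_add]
      exact merge_mem_polystrip hδ hk hz ht
  simp only [← merge_eq_pi_add, restrict_mu_cube] at hint
  exact hint

lemma integrable_comp_merge (hδ : ∀ i, 0 < δ i) (hg : ContinuousOn g (polystrip δ))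
    (hk : k ≤ d) {z : Fin k → ℂ} (hz : z ∈ polystrip (Fin.take k hk δ)) :
    Integrable (fun t => g (merge z (toComplex t))) (mu {i : Fin d // k ≤ i.val}) := by
  rw [← restrict_mu_cube]
  exact (hg.comp (continuous_merge_toComplex z).continuousOn
    fun t ht => merge_mem_polystrip hδ hk hz ht).integrableOn_compact isCompact_cube

lemma norm_complexMarginal_sub_le (hδ : ∀ i, 0 < δ i) (hg : ContinuousOn g (polystrip δ))
    (hk : k ≤ d) {z w : Fin k → ℂ} (hz : z ∈ polystrip (Fin.take k hk δ))
    (hw : w ∈ polystrip (Fin.take k hk δ)) {B : ℝ} (hB : ∀ t ∈ cube {i : Fin d // k ≤ i.val},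
      ‖g (merge z (toComplex t)) - g (merge w (toComplex t))‖ ≤ B) :
    ‖complexMarginal g k z - complexMarginal g k w‖ ≤ B := by
  unfold complexMarginal
  rw [← integral_sub (integrable_comp_merge hδ hg hk hz) (integrable_comp_merge hδ hg hk hw)]
  simpa using norm_integral_le_of_norm_le_const (ae_mem_cube.mono hB)

lemma complexMarginal_toComplex (hext : ∀ x ∈ cube (Fin d), g (toComplex x) = f x)
    {x : Fin k → ℝ} (hx : x ∈ cube (Fin k)) :
    complexMarginal g k (toComplex x) = marginal f k x := by
  unfold complexMarginal marginal
  rw [← integral_complex_ofReal]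
  refine integral_congr_ae (ae_mem_cube.mono fun t ht => ?_)
  simp only [← toComplex_merge]
  exact hext _ (merge_mem_cube hx ht)

/-- The indices from `k` on are the index `k` and the indices from `k + 1` on. -/
def optionTailEquiv (hk : k < d) :
    Option {i : Fin d // k + 1 ≤ i.val} ≃ {i : Fin d // k ≤ i.val} where
  toFun j := j.elim ⟨⟨k, hk⟩, le_rfl⟩ fun i => ⟨i, (Nat.le_succ k).trans i.2⟩
  invFun i := if h : i.val.val = k then none else some ⟨i, by grind⟩
  left_inv j := by cases j <;> grind
  right_inv i := by grind

/-- The vector with entry `p.2` at the index `k` and entries `p.1` at the later indices. -/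
def consTail (hk : k < d) :
    ({i : Fin d // k + 1 ≤ i.val} → ℝ) × ℝ ≃ᵐ ({i : Fin d // k ≤ i.val} → ℝ) :=
  (MeasurableEquiv.piOptionEquivProd fun _ => ℝ).symm.trans
    (MeasurableEquiv.piCongrLeft (fun _ => ℝ) (optionTailEquiv hk))

lemma measurePreserving_consTail (hk : k < d) :
    MeasurePreserving (consTail hk) ((mu {i : Fin d // k + 1 ≤ i.val}).prod mu₁)
      (mu {i : Fin d // k ≤ i.val}) :=
  (measurePreserving_piCongrLeft (fun _ => mu₁) (optionTailEquiv hk)).comp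
    ⟨(MeasurableEquiv.piOptionEquivProd fun _ => ℝ).symm.measurable,
      Measure.pi_map_piOptionEquivProd fun _ => mu₁⟩

lemma consTail_optionTailEquiv (hk : k < d) (p : ({i : Fin d // k + 1 ≤ i.val} → ℝ) × ℝ)
    (j : Option {i : Fin d // k + 1 ≤ i.val}) :
    consTail hk p (optionTailEquiv hk j) = j.elim p.2 p.1 := by
  rw [consTail, MeasurableEquiv.trans_apply, MeasurableEquiv.coe_piCongrLeft,
    Equiv.piCongrLeft_apply_apply]
  cases j <;> rfl

lemma merge_consTail (hk : k < d) (z : Fin k → ℂ) (p : ({i : Fin d // k + 1 ≤ i.val} → ℝ) × ℝ) :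
    merge z (toComplex (consTail hk p)) =
      merge (Fin.snoc (α := fun _ => ℂ) z (p.2 : ℂ) : Fin (k + 1) → ℂ) (toComplex p.1) := by
  ext i
  rcases lt_trichotomy i.val k with h | h | h
  · simp [merge, h, Nat.lt_succ_of_lt h, Fin.snoc]
  · obtain rfl : i = ⟨k, hk⟩ := Fin.ext h
    have hlast := consTail_optionTailEquiv hk p none
    simp only [optionTailEquiv, Equiv.coe_fn_mk, Option.elim_none] at hlast
    simp [merge, toComplex, Fin.snoc, ← hlast]
  · have hlater := consTail_optionTailEquiv hk p (some ⟨i, h⟩)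
    simp only [optionTailEquiv, Equiv.coe_fn_mk, Option.elim_some] at hlater
    simp [merge, toComplex, not_lt.2 h.le, not_lt.2 (Nat.succ_le_of_lt h), ← hlater]

lemma integral_complexMarginal_succ (hδ : ∀ i, 0 < δ i) (hg : ContinuousOn g (polystrip δ))
    (hk : k < d) {z : Fin k → ℂ} (hz : z ∈ polystrip (Fin.take k hk.le δ)) :
    ∫ s : ℝ, complexMarginal g (k + 1) (Fin.snoc (α := fun _ => ℂ) z (s : ℂ)) ∂mu₁ =
      complexMarginal g k z := by
  have hint := integrable_comp_merge hδ hg hk.le hz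
  calc ∫ s : ℝ, complexMarginal g (k + 1) (Fin.snoc (α := fun _ => ℂ) z (s : ℂ)) ∂mu₁
      = ∫ s : ℝ, ∫ t, g (merge z (toComplex (consTail hk (t, s)))) ∂mu _ ∂mu₁ := by
        simp only [merge_consTail, complexMarginal]
    _ = ∫ p, g (merge z (toComplex (consTail hk p))) ∂(mu _).prod mu₁ :=
        (integral_prod_symm _
          ((measurePreserving_consTail hk).integrable_comp_of_integrable hint)).symm
    _ = complexMarginal g k z :=
        (measurePreserving_consTail hk).integral_comp (consTail hk).measurableEmbedding
          fun t => g (merge z (toComplex t))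

end Marginal

/-! ### Complex conditional densities -/

/-- `f` is a function on `[-1,1]^d` with values in `[M, L]`, and `g` is a holomorphic extension of
it to the polystrip of radii `δ`, with small variation, as measured by `C`. This is
`DensityAssumption` without measurability, without the normalization of `f` and without the bounds
on `g` away from the cube. -/
structure UnnormalizedDensityAssumption {d : ℕ} (M L C : ℝ) (δ : Fin d → ℝ)
    (f : (Fin d → ℝ) → ℝ) (g : (Fin d → ℂ) → ℂ) : Prop where
  mem_Icc : ∀ x ∈ cube (Fin d), f x ∈ Icc M L
  extends_f : ∀ x ∈ cube (Fin d), g (toComplex x) = (f x : ℂ)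
  contDiffOn : ContDiffOn ℂ 1 g (polystrip δ)
  small : ∀ x ∈ cube (Fin d), ∀ y : Fin d → ℂ, (∀ i, ‖y i‖ < δ i) →
    ‖g (toComplex x + y) - g (toComplex x)‖ ≤ C
  small_partial : ∀ x ∈ cube (Fin d), ∀ j : Fin d, 1 ≤ j.val → ∀ y : Fin d → ℂ,
    (∀ i, i < j → ‖y i‖ < δ i) → (∀ i, j ≤ i → y i = 0) →
    ‖g (toComplex x + y) - g (toComplex x)‖ ≤ C * δ j

/-- Complex perturbations by less than `δ` of the first `j` coordinates of a point of the real cube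
change `g` by at most `B`. -/
def HasVariationLE {d : ℕ} (δ : Fin d → ℝ) (g : (Fin d → ℂ) → ℂ) (j : ℕ) (B : ℝ) : Prop :=
  ∀ x ∈ cube (Fin d), ∀ y : Fin d → ℂ, (∀ i, i.val < j → ‖y i‖ < δ i) →
    (∀ i, j ≤ i.val → y i = 0) → ‖g (toComplex x + y) - g (toComplex x)‖ ≤ B

/-- The extension of `condDensity` to complex arguments. -/
def complexCondDensity {d : ℕ} (g : (Fin d → ℂ) → ℂ) (k : ℕ) (z : Fin (k + 1) → ℂ) : ℂ :=
  complexMarginal g (k + 1) z / complexMarginal g k (Fin.init z)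

lemma HasVariationLE.norm_complexMarginal_sub_marginal_le {d k j : ℕ} {δ : Fin d → ℝ}
    {f : (Fin d → ℝ) → ℝ} {g : (Fin d → ℂ) → ℂ} {B : ℝ} (hvar : HasVariationLE δ g j B)
    (hδ : ∀ i, 0 < δ i) (hg : ContinuousOn g (polystrip δ))
    (hext : ∀ x ∈ cube (Fin d), g (toComplex x) = f x) (hk : k ≤ d) {z : Fin k → ℂ}
    (hz : z ∈ polystrip (Fin.take k hk δ)) {x : Fin k → ℝ} (hx : x ∈ cube (Fin k))
    (hlt : ∀ i : Fin k, i.val < j → ‖z i - x i‖ < δ (Fin.castLE hk i))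
    (heq : ∀ i : Fin k, j ≤ i.val → z i = x i) :
    ‖complexMarginal g k z - marginal f k x‖ ≤ B := by
  rw [← complexMarginal_toComplex hext hx]
  refine norm_complexMarginal_sub_le hδ hg hk hz
    (toComplex_mem_polystrip (fun i => hδ _) hx) fun t ht => ?_
  have hle := hvar _ (merge_mem_cube hx ht) (merge z (toComplex t) - toComplex (merge x t))
    (fun i hi => by
      rw [toComplex_merge]
      by_cases hik : i.val < k
      · simp only [Pi.sub_apply, merge, hik, dite_true]
        exact hlt ⟨i, hik⟩ hi
      · simpa [merge, hik] using hδ i)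
    (fun i hi => by
      rw [toComplex_merge]
      by_cases hik : i.val < k
      · simpa [merge, hik, toComplex, sub_eq_zero] using heq ⟨i, hik⟩ hi
      · simp [merge, hik])
  rwa [add_sub_cancel, toComplex_merge] at hle

lemma norm_div_sub_div_le {𝕜 : Type*} [NormedField 𝕜] {M L B : ℝ} (hM : 0 < M) (hML : M ≤ L)
    (hB : B ≤ M / 2) {a b a₀ b₀ : 𝕜} (ha₀ : ‖a₀‖ ≤ L) (hb₀ : M ≤ ‖b₀‖) (ha : ‖a - a₀‖ ≤ B)
    (hb : ‖b - b₀‖ ≤ B) : ‖a / b - a₀ / b₀‖ ≤ 4 * L / M ^ 2 * B := by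
  have hB₀ : 0 ≤ B := (norm_nonneg _).trans ha
  have hL : 0 ≤ L := hM.le.trans hML
  have hb_norm : M / 2 ≤ ‖b‖ := by
    have htri := norm_sub_norm_le b₀ b
    rw [norm_sub_rev] at htri
    linarith
  have hb_ne : b ≠ 0 := norm_pos_iff.1 (by linarith)
  have hb₀_ne : b₀ ≠ 0 := norm_pos_iff.1 (by linarith)
  have hdiff : a / b - a₀ / b₀ = (a - a₀) / b - a₀ * (b - b₀) / (b * b₀) := by
    field_simp
    ring
  calc ‖a / b - a₀ / b₀‖ ≤ ‖(a - a₀) / b‖ + ‖a₀ * (b - b₀) / (b * b₀)‖ := by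
        rw [hdiff]
        exact norm_sub_le _ _
    _ ≤ B / (M / 2) + L * B / (M / 2 * M) := by
        simp only [norm_div, norm_mul]
        gcongr
    _ ≤ L * B / (M / 2 * M) + L * B / (M / 2 * M) := by
        refine add_le_add_left ?_ _
        rw [div_le_div_iff₀ (by positivity) (by positivity)]
        nlinarith [mul_le_mul_of_nonneg_left hML (mul_nonneg hB₀ (half_pos hM).le)]
    _ = 4 * L / M ^ 2 * B := by
        field_simp
        ring

namespace UnnormalizedDensityAssumption

variable {d : ℕ} {M L C : ℝ} {δ : Fin d → ℝ} {f : (Fin d → ℝ) → ℝ} {g : (Fin d → ℂ) → ℂ}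

lemma hasVariationLE (h : UnnormalizedDensityAssumption M L C δ f g) (hδ : ∀ i, 0 < δ i) (j : ℕ) :
    HasVariationLE δ g j C := by
  intro x hx y hlt heq
  refine h.small x hx y fun i => ?_
  rcases lt_or_ge i.val j with hij | hij
  · exact hlt i hij
  · simpa [heq i hij] using hδ i

lemma hasVariationLE_mul_min (h : UnnormalizedDensityAssumption M L C δ f g) (hδ : ∀ i, 0 < δ i)
    (j : Fin d) : HasVariationLE δ g j (C * min 1 (δ j)) := by
  intro x hx y hlt heq
  have hle : ‖g (toComplex x + y) - g (toComplex x)‖ ≤ C := h.hasVariationLE hδ j x hx y hlt heq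
  have hC : 0 ≤ C := (norm_nonneg _).trans hle
  rcases Nat.eq_zero_or_pos j.val with hj | hj
  · obtain rfl : y = 0 := funext fun i => heq i (by simp [hj])
    have hδj := hδ j
    rw [add_zero, sub_self, norm_zero]
    positivity
  · rw [mul_min_of_nonneg _ _ hC, mul_one]
    exact le_min hle (h.small_partial x hx j hj y hlt heq)

lemma marginal_mem_Icc (h : UnnormalizedDensityAssumption M L C δ f g) (hδ : ∀ i, 0 < δ i) {k : ℕ}
    (hk : k ≤ d) {x : Fin k → ℝ} (hx : x ∈ cube (Fin k)) : marginal f k x ∈ Icc M L := by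
  have hmem : ∀ᵐ t ∂mu {i : Fin d // k ≤ i.val}, f (merge x t) ∈ Icc M L :=
    ae_mem_cube.mono fun t ht => h.mem_Icc _ (merge_mem_cube hx ht)
  have hint : Integrable (fun t => f (merge x t)) (mu {i : Fin d // k ≤ i.val}) := by
    have hcomplex := integrable_comp_merge hδ h.contDiffOn.continuousOn hk
      (toComplex_mem_polystrip (δ := Fin.take k hk δ) (fun i => hδ _) hx)
    refine hcomplex.re.congr (ae_mem_cube.mono fun t ht => ?_)
    simp [← toComplex_merge, h.extends_f _ (merge_mem_cube hx ht)]
  exact (convex_Icc M L).integral_mem isClosed_Icc hmem hint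

lemma condDensity_mem_Icc (h : UnnormalizedDensityAssumption M L C δ f g) (hδ : ∀ i, 0 < δ i)
    (hM : 0 < M) {k : ℕ} (hk : k < d) {x : Fin (k + 1) → ℝ} (hx : x ∈ cube (Fin (k + 1))) :
    condDensity f k x ∈ Icc (M / L) (L / M) := by
  have hnum := h.marginal_mem_Icc hδ hk hx
  have hden := h.marginal_mem_Icc hδ hk.le (x := Fin.init x) fun i => hx _
  have hL : 0 ≤ L := hM.le.trans (hnum.1.trans hnum.2)
  exact ⟨div_le_div₀ (hM.le.trans hnum.1) hnum.1 (hM.trans_le hden.1) hden.2,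
    div_le_div₀ hL hnum.2 hM hden.1⟩

lemma complexMarginal_ne_zero (h : UnnormalizedDensityAssumption M L C δ f g) (hδ : ∀ i, 0 < δ i)
    (hC : C < M) {k : ℕ} (hk : k ≤ d) {z : Fin k → ℂ} (hz : z ∈ polystrip (Fin.take k hk δ)) :
    complexMarginal g k z ≠ 0 := by
  obtain ⟨x, hx, hxz⟩ := exists_cube_of_mem_polystrip hz
  have hdist := (h.hasVariationLE hδ k).norm_complexMarginal_sub_marginal_le hδ
    h.contDiffOn.continuousOn h.extends_f hk hz hx (fun i _ => hxz i)
    fun i hi => absurd i.2 (not_lt.2 hi)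
  intro h0
  rw [h0, zero_sub, norm_neg, Complex.norm_real] at hdist
  linarith [(h.marginal_mem_Icc hδ hk hx).1, Real.le_norm_self (marginal f k x)]

lemma complexCondDensity_ne_zero (h : UnnormalizedDensityAssumption M L C δ f g)
    (hδ : ∀ i, 0 < δ i) (hC : C < M) {k : ℕ} (hk : k < d) {z : Fin (k + 1) → ℂ}
    (hz : z ∈ polystrip (Fin.take (k + 1) hk δ)) : complexCondDensity g k z ≠ 0 :=
  div_ne_zero (h.complexMarginal_ne_zero hδ hC hk hz)
    (h.complexMarginal_ne_zero hδ hC hk.le fun i => hz i.castSucc)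

lemma contDiffOn_complexCondDensity (h : UnnormalizedDensityAssumption M L C δ f g)
    (hδ : ∀ i, 0 < δ i) (hC : C < M) {k : ℕ} (hk : k < d) :
    ContDiffOn ℂ 1 (complexCondDensity g k) (polystrip (Fin.take (k + 1) hk δ)) :=
  (contDiffOn_complexMarginal hδ h.contDiffOn hk).div
    ((contDiffOn_complexMarginal hδ h.contDiffOn hk.le).comp
      (by unfold Fin.init; fun_prop) fun z hz i => hz i.castSucc)
    fun z hz => h.complexMarginal_ne_zero hδ hC hk.le fun i => hz i.castSucc

lemma complexCondDensity_toComplex (h : UnnormalizedDensityAssumption M L C δ f g) {k : ℕ}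
    {x : Fin (k + 1) → ℝ} (hx : x ∈ cube (Fin (k + 1))) :
    complexCondDensity g k (toComplex x) = condDensity f k x := by
  have hinit := complexMarginal_toComplex h.extends_f (k := k) (x := Fin.init x) fun i => hx _
  rw [complexCondDensity, complexMarginal_toComplex h.extends_f hx, condDensity,
    Complex.ofReal_div, ← hinit]
  rfl

lemma norm_complexCondDensity_sub_le (h : UnnormalizedDensityAssumption M L C δ f g)
    (hδ : ∀ i, 0 < δ i) (hM : 0 < M) {j : ℕ} {B : ℝ} (hvar : HasVariationLE δ g j B)
    (hB : B ≤ M / 2) {k : ℕ} (hk : k < d) {z : Fin (k + 1) → ℂ}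
    (hz : z ∈ polystrip (Fin.take (k + 1) hk δ)) {x : Fin (k + 1) → ℝ}
    (hx : x ∈ cube (Fin (k + 1)))
    (hlt : ∀ i : Fin (k + 1), i.val < j → ‖z i - x i‖ < δ (Fin.castLE hk i))
    (heq : ∀ i : Fin (k + 1), j ≤ i.val → z i = x i) :
    ‖complexCondDensity g k z - condDensity f k x‖ ≤ 4 * L / M ^ 2 * B := by
  have hnum := h.marginal_mem_Icc hδ hk hx
  have hx' : Fin.init x ∈ cube (Fin k) := fun i => hx i.castSucc
  have hden := h.marginal_mem_Icc hδ hk.le hx'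
  have hg := h.contDiffOn.continuousOn
  rw [condDensity, Complex.ofReal_div]
  refine norm_div_sub_div_le hM (hnum.1.trans hnum.2) hB ?_ ?_
    (hvar.norm_complexMarginal_sub_marginal_le hδ hg h.extends_f hk hz hx hlt heq)
    (hvar.norm_complexMarginal_sub_marginal_le hδ hg h.extends_f hk.le (fun i => hz i.castSucc)
      hx' (fun i hi => hlt i.castSucc hi) fun i hi => heq i.castSucc hi)
  · rw [Complex.norm_real, Real.norm_of_nonneg (hM.le.trans hnum.1)]
    exact hnum.2
  · rw [Complex.norm_real]
    exact hden.1.trans (Real.le_norm_self _)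

end UnnormalizedDensityAssumption

/-- A bound for the variation of the densities that makes all conditional densities complex
densities: their imaginary part is then at most `M / L / 64 = 1 / (32 * l)` for `l = 2 * L / M`. -/
def maxVariation (M L : ℝ) : ℝ := M ^ 3 / (256 * L ^ 2)

lemma maxVariation_pos {M L : ℝ} (hM : 0 < M) (hML : M ≤ L) : 0 < maxVariation M L := by
  have hL : 0 < L := hM.trans_le hML
  unfold maxVariation
  positivity

lemma maxVariation_le_half {M L : ℝ} (hM : 0 < M) (hML : M ≤ L) : maxVariation M L ≤ M / 2 := by
  have hL : 0 < L := hM.trans_le hML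
  rw [maxVariation, div_le_div_iff₀ (by positivity) two_pos]
  nlinarith [mul_le_mul hML hML hM.le hL.le]

lemma maxVariation_lt {M L : ℝ} (hM : 0 < M) (hML : M ≤ L) : maxVariation M L < M :=
  (maxVariation_le_half hM hML).trans_lt (half_lt_self hM)

lemma mul_maxVariation {M L : ℝ} (hM : 0 < M) (hML : M ≤ L) :
    4 * L / M ^ 2 * maxVariation M L = M / L / 64 := by
  have hL : 0 < L := hM.trans_le hML
  unfold maxVariation
  field_simp
  norm_num

/-- The conditional density of the variable with index `k`, given complex values `z` of the
variables before it. -/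
def complexCondSlice {d : ℕ} (g : (Fin d → ℂ) → ℂ) (k : ℕ) (z : Fin k → ℂ) (s : ℂ) : ℂ :=
  complexCondDensity g k (Fin.snoc (α := fun _ => ℂ) z s)

namespace UnnormalizedDensityAssumption

variable {d : ℕ} {M L C : ℝ} {δ : Fin d → ℝ} {f : (Fin d → ℝ) → ℝ} {g : (Fin d → ℂ) → ℂ} {k : ℕ}

lemma le (h : UnnormalizedDensityAssumption M L C δ f g) : M ≤ L :=
  have hzero := h.mem_Icc 0 fun _ => by simp
  hzero.1.trans hzero.2

lemma exists_norm_complexCondSlice_sub_le (h : UnnormalizedDensityAssumption M L C δ f g)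
    (hδ : ∀ i, 0 < δ i) (hM : 0 < M) (hC : C ≤ M / 2) (hk : k < d) {z : Fin k → ℂ}
    (hz : z ∈ polystrip (Fin.take k hk.le δ)) {s : ℂ} (hs : s ∈ strip (δ ⟨k, hk⟩)) :
    ∃ r ∈ Icc (M / L) (L / M),
      ‖complexCondSlice g k z s - (r : ℝ)‖ ≤ 4 * L / M ^ 2 * C := by
  have hmem := snoc_mem_polystrip_take hk hz hs
  obtain ⟨x, hx, hxz⟩ := exists_cube_of_mem_polystrip hmem
  exact ⟨condDensity f k x, h.condDensity_mem_Icc hδ hM hk hx,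
    h.norm_complexCondDensity_sub_le hδ hM (h.hasVariationLE hδ (k + 1)) hC hk hmem hx
      (fun i _ => hxz i) fun i hi => absurd i.2 (not_lt.2 hi)⟩

lemma abs_im_complexCondSlice_ofReal_le (h : UnnormalizedDensityAssumption M L C δ f g)
    (hδ : ∀ i, 0 < δ i) (hM : 0 < M) (hC : C ≤ M / 2) (hk : k < d) {z : Fin k → ℂ}
    (hz : z ∈ polystrip (Fin.take k hk.le δ)) {t : ℝ} (ht : t ∈ Icc (-1 : ℝ) 1) :
    |(complexCondSlice g k z t).im| ≤
      4 * L / M ^ 2 * (C * min 1 (δ ⟨k, hk⟩)) := by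
  obtain ⟨x, hx, hxz⟩ := exists_cube_of_mem_polystrip hz
  have hvar := h.hasVariationLE_mul_min hδ ⟨k, hk⟩
  have hC₀ : 0 ≤ C := (norm_nonneg _).trans
    (h.small 0 (fun _ => by simp) 0 fun i => by simpa using hδ i)
  have hdist := h.norm_complexCondDensity_sub_le hδ hM hvar
    ((mul_le_of_le_one_right hC₀ (min_le_left _ _)).trans hC) hk
    (snoc_mem_polystrip_take hk hz (ofReal_mem_strip (hδ _) ht)) (snoc_mem_cube hx ht)
    (Fin.lastCases (fun hi => absurd hi (lt_irrefl _)) fun i _ => by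
      rw [Fin.snoc_castSucc, Fin.snoc_castSucc]
      exact hxz i)
    (Fin.lastCases (fun _ => by simp only [Fin.snoc_last]) fun i hi => absurd i.2 (not_lt.2 hi))
  refine le_trans ?_ hdist
  simpa [complexCondSlice] using
    Complex.abs_im_le_norm (complexCondSlice g k z t - (condDensity f k (Fin.snoc x t) : ℝ))

lemma contDiffOn_complexCondSlice (h : UnnormalizedDensityAssumption M L C δ f g)
    (hδ : ∀ i, 0 < δ i) (hC : C < M) (hk : k < d) {E : Type*} [NormedAddCommGroup E]
    [NormedSpace ℂ E] {U : Set E} {u : E → Fin k → ℂ} (hu : ContDiffOn ℂ 1 u U)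
    (hu_mem : MapsTo u U (polystrip (Fin.take k hk.le δ))) :
    ContDiffOn ℂ 1 (fun p : E × ℂ => complexCondSlice g k (u p.1) p.2)
      (U ×ˢ strip (δ ⟨k, hk⟩)) :=
  (h.contDiffOn_complexCondDensity hδ hC hk).comp
    (contDiff_snoc.comp_contDiffOn
      ((hu.comp contDiffOn_fst fun _ hp => hp.1).prodMk contDiffOn_snd))
    fun _ hp => snoc_mem_polystrip_take hk (hu_mem hp.1) hp.2

lemma differentiableOn_complexCondSlice (h : UnnormalizedDensityAssumption M L C δ f g)
    (hδ : ∀ i, 0 < δ i) (hC : C < M) (hk : k < d) {z : Fin k → ℂ}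
    (hz : z ∈ polystrip (Fin.take k hk.le δ)) :
    DifferentiableOn ℂ (complexCondSlice g k z) (strip (δ ⟨k, hk⟩)) :=
  ((h.contDiffOn_complexCondSlice hδ hC hk contDiffOn_id (mapsTo_id _)).comp
    (contDiff_prodMk_right z).contDiffOn fun _ hs => ⟨hz, hs⟩).differentiableOn one_ne_zero

lemma complexCDF_complexCondSlice_toComplex (h : UnnormalizedDensityAssumption M L C δ f g)
    (hδ : ∀ i, 0 < δ i) (hC : C < M) (hk : k < d) {x : Fin k → ℝ} (hx : x ∈ cube (Fin k)) {t : ℝ}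
    (ht : t ∈ Icc (-1 : ℝ) 1) :
    complexCDF (complexCondSlice g k (toComplex x)) t = (condCDF f k x t : ℝ) := by
  have hz : toComplex x ∈ polystrip (Fin.take k hk.le δ) :=
    toComplex_mem_polystrip (fun _ => hδ _) hx
  have hslice : ∀ τ ∈ uIcc (-1 : ℝ) t, complexCondSlice g k (toComplex x) τ =
      (condDensity f k (Fin.snoc x τ) : ℝ) := by
    intro τ hτ
    rw [uIcc_of_le ht.1] at hτ
    rw [complexCondSlice, ← toComplex_snoc,
      h.complexCondDensity_toComplex (snoc_mem_cube hx ⟨hτ.1, hτ.2.trans ht.2⟩)]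
  rw [complexCDF_ofReal (hδ _) (h.differentiableOn_complexCondSlice hδ hC hk hz) ht,
    intervalIntegral.integral_congr hslice, intervalIntegral.integral_ofReal, condCDF]
  push_cast
  rfl

lemma integral_complexCondSlice (h : UnnormalizedDensityAssumption M L C δ f g)
    (hδ : ∀ i, 0 < δ i) (hC : C < M) (hk : k < d) {z : Fin k → ℂ}
    (hz : z ∈ polystrip (Fin.take k hk.le δ)) :
    ∫ t : ℝ, complexCondSlice g k z t ∂mu₁ = 1 := by
  simp only [complexCondSlice, complexCondDensity, Fin.init_snoc, integral_div,
    integral_complexMarginal_succ hδ h.contDiffOn.continuousOn hk hz]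
  exact div_self (h.complexMarginal_ne_zero hδ hC hk.le hz)

lemma isComplexDensity (h : UnnormalizedDensityAssumption M L (maxVariation M L) δ f g)
    (hδ : ∀ i, 0 < δ i) (hM : 0 < M) (hk : k < d) {z : Fin k → ℂ}
    (hz : z ∈ polystrip (Fin.take k hk.le δ)) :
    IsComplexDensity (2 * L / M) (δ ⟨k, hk⟩) (complexCondSlice g k z) := by
  have hML := h.le
  have hL : 0 < L := hM.trans_le hML
  have hC := maxVariation_le_half hM hML
  have hCM := maxVariation_lt hM hML
  have hvar := mul_maxVariation hM hML
  have hinv : (2 * L / M)⁻¹ = M / L / 2 := by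
    field_simp
  have hML_div : M / L ≤ 1 := (div_le_one hL).2 hML
  have hLM_div : 1 ≤ L / M := (one_le_div hM).2 hML
  have hbounds : ∀ s ∈ strip (δ ⟨k, hk⟩), ‖complexCondSlice g k z s‖ ≤ 2 * L / M ∧
      (2 * L / M)⁻¹ ≤ (complexCondSlice g k z s).re ∧
      |(complexCondSlice g k z s).im| ≤ (2 * (2 * L / M))⁻¹ := by
    intro s hs
    obtain ⟨r, hr, hdist⟩ := h.exists_norm_complexCondSlice_sub_le hδ hM hC hk hz hs
    rw [hvar] at hdist
    have hnorm := norm_le_norm_add_norm_sub' (complexCondSlice g k z s) r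
    have hre := (abs_le.1 ((Complex.abs_re_le_norm _).trans hdist)).1
    have him := (Complex.abs_im_le_norm _).trans hdist
    rw [Complex.norm_real, Real.norm_of_nonneg (hr.1.trans' (by positivity))] at hnorm
    rw [Complex.sub_re, Complex.ofReal_re] at hre
    rw [Complex.sub_im, Complex.ofReal_im, sub_zero] at him
    rw [mul_inv, hinv, mul_div_assoc]
    have hpos : 0 < M / L := by positivity
    exact ⟨by linarith [hr.2], by linarith [hr.1], by linarith⟩
  refine ⟨hδ _, h.differentiableOn_complexCondSlice hδ hCM hk hz,
    h.integral_complexCondSlice hδ hCM hk hz, fun s hs => (hbounds s hs).1,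
    fun s hs => (hbounds s hs).2.1, fun s hs => (hbounds s hs).2.2, fun t ht => ?_⟩
  refine (h.abs_im_complexCondSlice_ofReal_le hδ hM hC hk hz ht).trans_eq ?_
  rw [← mul_assoc, hvar]
  field_simp
  ring

lemma isComplexDensity_toComplex (h : UnnormalizedDensityAssumption M L (maxVariation M L) δ f g)
    (hδ : ∀ i, 0 < δ i) (hM : 0 < M) (hk : k < d) {x : Fin k → ℝ} (hx : x ∈ cube (Fin k)) :
    IsComplexDensity (2 * L / M) (δ ⟨k, hk⟩) (complexCondSlice g k (toComplex x)) :=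
  h.isComplexDensity hδ hM hk (toComplex_mem_polystrip (fun _ => hδ _) hx)

end UnnormalizedDensityAssumption

/-! ### The complex Knothe–Rosenblatt map -/

/-- The first `k` components of the extension of `krMap` to complex arguments near the cube. -/
def complexKRMap {d : ℕ} (δ : Fin d → ℝ) (gρ gπ : (Fin d → ℂ) → ℂ) :
    (k : ℕ) → k ≤ d → (Fin k → ℂ) → (Fin k → ℂ)
  | 0, _, _ => Fin.elim0
  | k + 1, hk, z =>
    Fin.snoc (α := fun _ => ℂ) (complexKRMap δ gρ gπ k (Nat.le_of_succ_le hk) (Fin.init z))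
      (transport (δ ⟨k, hk⟩) (complexCondSlice gρ k (Fin.init z))
        (complexCondSlice gπ k (complexKRMap δ gρ gπ k (Nat.le_of_succ_le hk) (Fin.init z)))
        (z (Fin.last k)))

/-- The derivative of the component with index `k` of `complexKRMap` in its last variable. -/
def complexKRDeriv {d : ℕ} (δ : Fin d → ℝ) (gρ gπ : (Fin d → ℂ) → ℂ) (k : ℕ) (hk : k < d)
    (z : Fin (k + 1) → ℂ) : ℂ :=
  complexCondDensity gρ k z / complexCondDensity gπ k (complexKRMap δ gρ gπ (k + 1) hk z)

/-- The polystrip in the first `k` variables in which `complexKRMap` is controlled. The factor of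
the radii is `1 / (8 * l ^ 2)` for `l = 2 * L / M`, as in `IsComplexDensity.transport_mem`. -/
def krDomain {d : ℕ} (M L : ℝ) (δ : Fin d → ℝ) (k : ℕ) (hk : k ≤ d) : Set (Fin k → ℂ) :=
  polystrip fun i => (8 * (2 * L / M) ^ 2)⁻¹ * δ (Fin.castLE hk i)

section ComplexKRMap

variable {d : ℕ} {M L : ℝ} {δ : Fin d → ℝ} {fρ fπ : (Fin d → ℝ) → ℝ} {gρ gπ : (Fin d → ℂ) → ℂ}
  {k : ℕ}

lemma last_mem_strip (hk : k < d) {z : Fin (k + 1) → ℂ} (hz : z ∈ krDomain M L δ (k + 1) hk) :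
    z (Fin.last k) ∈ strip (δ ⟨k, hk⟩ / (8 * (2 * L / M) ^ 2)) := by
  rw [← inv_mul_eq_div]
  exact hz (Fin.last k)

lemma init_mem_krDomain (hk : k < d) {z : Fin (k + 1) → ℂ} (hz : z ∈ krDomain M L δ (k + 1) hk) :
    Fin.init z ∈ krDomain M L δ k hk.le :=
  fun i => hz i.castSucc

lemma krDomain_subset (hδ : ∀ i, 0 < δ i) (hM : 0 < M) (hML : M ≤ L) (hk : k ≤ d) :
    krDomain M L δ k hk ⊆ polystrip (Fin.take k hk δ) := by
  intro z hz i
  have hl : 1 ≤ 2 * L / M := (one_le_div hM).2 (by linarith)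
  refine thickening_mono (mul_le_of_le_one_left (hδ _).le (inv_le_one_of_one_le₀ ?_)) _ (hz i)
  nlinarith

lemma toComplex_mem_krDomain (hδ : ∀ i, 0 < δ i) (hM : 0 < M) (hML : M ≤ L) (hk : k ≤ d)
    {x : Fin k → ℝ} (hx : x ∈ cube (Fin k)) : toComplex x ∈ krDomain M L δ k hk := by
  have hL : 0 < L := hM.trans_le hML
  exact toComplex_mem_polystrip (fun i => mul_pos (by positivity) (hδ _)) hx

lemma UnnormalizedDensityAssumption.isComplexDensity_of_mem_krDomain {f : (Fin d → ℝ) → ℝ}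
    {g : (Fin d → ℂ) → ℂ} (h : UnnormalizedDensityAssumption M L (maxVariation M L) δ f g)
    (hδ : ∀ i, 0 < δ i) (hM : 0 < M) (hk : k < d) {z : Fin k → ℂ}
    (hz : z ∈ krDomain M L δ k hk.le) :
    IsComplexDensity (2 * L / M) (δ ⟨k, hk⟩) (complexCondSlice g k z) :=
  h.isComplexDensity hδ hM hk (krDomain_subset hδ hM h.le _ hz)

lemma complexKRDeriv_eq (δ : Fin d → ℝ) (gρ gπ : (Fin d → ℂ) → ℂ) (hk : k < d)
    (z : Fin (k + 1) → ℂ) :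
    complexKRDeriv δ gρ gπ k hk z = complexCondSlice gρ k (Fin.init z) (z (Fin.last k)) /
      complexCondSlice gπ k (complexKRMap δ gρ gπ k hk.le (Fin.init z))
        (transport (δ ⟨k, hk⟩) (complexCondSlice gρ k (Fin.init z))
          (complexCondSlice gπ k (complexKRMap δ gρ gπ k hk.le (Fin.init z)))
          (z (Fin.last k))) := by
  rw [complexKRDeriv, complexCondSlice, Fin.snoc_init_self]
  rfl

variable (hρ : UnnormalizedDensityAssumption M L (maxVariation M L) δ fρ gρ)
  (hπ : UnnormalizedDensityAssumption M L (maxVariation M L) δ fπ gπ)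
  (hδ : ∀ i, 0 < δ i) (hM : 0 < M)

include hρ hπ hδ hM

lemma mapsTo_complexKRMap (hk : k ≤ d) :
    MapsTo (complexKRMap δ gρ gπ k hk) (krDomain M L δ k hk) (polystrip (Fin.take k hk δ)) := by
  induction k with
  | zero => exact fun z _ i => i.elim0
  | succ k ih =>
    intro z hz
    have hinit := init_mem_krDomain hk hz
    have hmem := ih _ hinit
    exact snoc_mem_polystrip_take hk hmem
      ((hρ.isComplexDensity_of_mem_krDomain hδ hM hk hinit).transport_mem
        (hπ.isComplexDensity hδ hM hk hmem) (last_mem_strip hk hz))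

lemma isComplexDensity_complexKRMap (hk : k < d) {z : Fin k → ℂ}
    (hz : z ∈ krDomain M L δ k hk.le) :
    IsComplexDensity (2 * L / M) (δ ⟨k, hk⟩)
      (complexCondSlice gπ k (complexKRMap δ gρ gπ k hk.le z)) :=
  hπ.isComplexDensity hδ hM hk (mapsTo_complexKRMap hρ hπ hδ hM hk.le hz)

lemma contDiffOn_complexKRMap (hk : k ≤ d) :
    ContDiffOn ℂ 1 (complexKRMap δ gρ gπ k hk) (krDomain M L δ k hk) := by
  induction k with
  | zero => exact contDiffOn_pi.2 fun i => i.elim0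
  | succ k ih =>
    have hk' : k ≤ d := Nat.le_of_succ_le hk
    have hinit : MapsTo Fin.init (krDomain M L δ (k + 1) hk) (krDomain M L δ k hk') :=
      fun z hz => init_mem_krDomain hk hz
    have hinit_contDiff : ContDiff ℂ 1 (Fin.init : (Fin (k + 1) → ℂ) → Fin k → ℂ) := by
      unfold Fin.init
      fun_prop
    have hT := (ih hk').comp hinit_contDiff.contDiffOn hinit
    have hmem := (mapsTo_complexKRMap hρ hπ hδ hM hk').comp hinit
    have hCM := maxVariation_lt hM hρ.le
    exact contDiff_snoc.comp_contDiffOn (hT.prodMk (contDiffOn_transport isOpen_polystrip (hδ _)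
      (fun z hz => hρ.isComplexDensity_of_mem_krDomain hδ hM hk (hinit hz))
      (fun z hz => isComplexDensity_complexKRMap hρ hπ hδ hM hk (hinit hz))
      (hρ.contDiffOn_complexCondSlice hδ hCM hk hinit_contDiff.contDiffOn
        (hinit.mono_right (krDomain_subset hδ hM hρ.le hk')))
      (hπ.contDiffOn_complexCondSlice hδ hCM hk hT hmem)
      (contDiff_apply ℂ ℂ (Fin.last k)).contDiffOn fun z hz => last_mem_strip hk hz))

lemma condCDF_mem_image (hk : k < d) {x y : Fin k → ℝ} (hx : x ∈ cube (Fin k))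
    (hy : y ∈ cube (Fin k)) {t : ℝ} (ht : t ∈ Icc (-1 : ℝ) 1) :
    condCDF fρ k x t ∈ condCDF fπ k y '' Icc (-1 : ℝ) 1 := by
  have hCM := maxVariation_lt hM hρ.le
  obtain ⟨s, hs, hre⟩ := (hπ.isComplexDensity_toComplex hδ hM hk hy).surjOn_re_complexCDF
    ((hρ.isComplexDensity_toComplex hδ hM hk hx).re_complexCDF_mem_Icc ht)
  simp only [hρ.complexCDF_complexCondSlice_toComplex hδ hCM hk hx ht,
    hπ.complexCDF_complexCondSlice_toComplex hδ hCM hk hy hs, Complex.ofReal_re] at hre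
  exact ⟨s, hs, hre⟩

lemma transport_toComplex (hk : k < d) {x y : Fin k → ℝ} (hx : x ∈ cube (Fin k))
    (hy : y ∈ cube (Fin k)) {t : ℝ} (ht : t ∈ Icc (-1 : ℝ) 1) :
    transport (δ ⟨k, hk⟩) (complexCondSlice gρ k (toComplex x))
        (complexCondSlice gπ k (toComplex y)) t =
      (Function.invFunOn (condCDF fπ k y) (Icc (-1) 1) (condCDF fρ k x t) : ℝ) := by
  have hCM := maxVariation_lt hM hρ.le
  have himage := condCDF_mem_image hρ hπ hδ hM hk hx hy ht
  have hmem := Function.invFunOn_mem himage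
  refine (hπ.isComplexDensity_toComplex hδ hM hk hy).transport_eq
    (ofReal_mem_strip (hδ _) hmem) ?_
  rw [hπ.complexCDF_complexCondSlice_toComplex hδ hCM hk hy hmem,
    hρ.complexCDF_complexCondSlice_toComplex hδ hCM hk hx ht, Function.invFunOn_eq himage]

lemma krMap_mem_cube (hk : k ≤ d) {x : Fin k → ℝ} (hx : x ∈ cube (Fin k)) :
    krMap fρ fπ k x ∈ cube (Fin k) := by
  induction k with
  | zero => exact fun i => i.elim0
  | succ k ih =>
    have hinit : Fin.init x ∈ cube (Fin k) := fun i => hx i.castSucc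
    have hmem := ih (Nat.le_of_succ_le hk) hinit
    exact snoc_mem_cube hmem
      (Function.invFunOn_mem (condCDF_mem_image hρ hπ hδ hM hk hinit hmem (hx (Fin.last k))))

lemma complexKRMap_toComplex (hk : k ≤ d) {x : Fin k → ℝ} (hx : x ∈ cube (Fin k)) :
    complexKRMap δ gρ gπ k hk (toComplex x) = toComplex (krMap fρ fπ k x) := by
  induction k with
  | zero => exact funext fun i => i.elim0
  | succ k ih =>
    have hk' : k ≤ d := Nat.le_of_succ_le hk
    have hinit : Fin.init x ∈ cube (Fin k) := fun i => hx i.castSucc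
    have hinit_toComplex : Fin.init (toComplex x) = toComplex (Fin.init x) := rfl
    rw [complexKRMap, hinit_toComplex, ih hk' hinit, krMap, toComplex_snoc,
      ← transport_toComplex hρ hπ hδ hM hk hinit (krMap_mem_cube hρ hπ hδ hM hk' hinit)
        (hx (Fin.last k))]
    rfl

lemma krComponent_update_last (hk : k < d) {x : Fin (k + 1) → ℝ}
    (hx : x ∈ cube (Fin (k + 1))) {s : ℝ} (hs : s ∈ Icc (-1 : ℝ) 1) :
    (krComponent fρ fπ k (Function.update x (Fin.last k) s) : ℂ) =
      transport (δ ⟨k, hk⟩) (complexCondSlice gρ k (Fin.init (toComplex x)))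
        (complexCondSlice gπ k (complexKRMap δ gρ gπ k hk.le (Fin.init (toComplex x)))) s := by
  have hinit : Fin.init x ∈ cube (Fin k) := fun i => hx i.castSucc
  have hinit_toComplex : Fin.init (toComplex x) = toComplex (Fin.init x) := rfl
  rw [hinit_toComplex, complexKRMap_toComplex hρ hπ hδ hM hk.le hinit,
    transport_toComplex hρ hπ hδ hM hk hinit (krMap_mem_cube hρ hπ hδ hM hk.le hinit) hs,
    krComponent, krMap, Fin.snoc_last, Fin.init_update_last, Function.update_self]

lemma hasDerivWithinAt_krComponent (hk : k < d) {x : Fin (k + 1) → ℝ}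
    (hx : x ∈ cube (Fin (k + 1))) :
    HasDerivWithinAt
      (fun s : ℝ => (krComponent fρ fπ k (Function.update x (Fin.last k) s) : ℂ))
      (complexKRDeriv δ gρ gπ k hk (toComplex x)) (Icc (-1 : ℝ) 1) (x (Fin.last k)) := by
  have hz := toComplex_mem_krDomain hδ hM hρ.le hk hx
  have hinit := init_mem_krDomain hk hz
  have hderiv := ((hρ.isComplexDensity_of_mem_krDomain hδ hM hk hinit).hasDerivAt_transport
    (isComplexDensity_complexKRMap hρ hπ hδ hM hk hinit) (last_mem_strip hk hz)).comp_ofReal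
  rw [complexKRDeriv_eq]
  exact hderiv.hasDerivWithinAt.congr
    (fun s hs => krComponent_update_last hρ hπ hδ hM hk hx hs)
    (krComponent_update_last hρ hπ hδ hM hk hx (hx (Fin.last k)))

lemma contDiffOn_complexKRDeriv (hk : k < d) :
    ContDiffOn ℂ 1 (complexKRDeriv δ gρ gπ k hk) (krDomain M L δ (k + 1) hk) := by
  have hCM := maxVariation_lt hM hρ.le
  have hmem := mapsTo_complexKRMap hρ hπ hδ hM hk
  exact ((hρ.contDiffOn_complexCondDensity hδ hCM hk).mono (krDomain_subset hδ hM hρ.le hk)).div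
    ((hπ.contDiffOn_complexCondDensity hδ hCM hk).comp
      (contDiffOn_complexKRMap hρ hπ hδ hM hk) hmem)
    fun z hz => hπ.complexCondDensity_ne_zero hδ hCM hk (hmem hz)

lemma norm_complexKRDeriv_sub_one_lt (hk : k < d) {z : Fin (k + 1) → ℂ}
    (hz : z ∈ krDomain M L δ (k + 1) hk) :
    ‖complexKRDeriv δ gρ gπ k hk z - 1‖ < 25 * (2 * L / M) ^ 4 := by
  have hinit := init_mem_krDomain hk hz
  have h₁ := hρ.isComplexDensity_of_mem_krDomain hδ hM hk hinit
  have h₂ := isComplexDensity_complexKRMap hρ hπ hδ hM hk hinit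
  rw [complexKRDeriv_eq]
  exact h₁.norm_div_sub_one_lt h₂ (h₁.strip_subset (last_mem_strip hk hz))
    (h₁.transport_mem h₂ (last_mem_strip hk hz))

lemma inv_le_re_complexKRDeriv (hk : k < d) {z : Fin (k + 1) → ℂ}
    (hz : z ∈ krDomain M L δ (k + 1) hk) :
    1 / (25 * (2 * L / M) ^ 4) ≤ (complexKRDeriv δ gρ gπ k hk z).re := by
  have hinit := init_mem_krDomain hk hz
  have h₁ := hρ.isComplexDensity_of_mem_krDomain hδ hM hk hinit
  have h₂ := isComplexDensity_complexKRMap hρ hπ hδ hM hk hinit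
  rw [complexKRDeriv_eq]
  exact h₁.inv_le_re_div h₂ (h₁.strip_subset (last_mem_strip hk hz))
    (h₁.transport_mem h₂ (last_mem_strip hk hz))

lemma norm_complexKRDeriv_sub_one_lt_div (hk : k < d) {z : Fin (k + 1) → ℂ}
    (hz : Fin.init z ∈ krDomain M L δ k hk.le) (hlast : z (Fin.last k) ∈ complexInterval) :
    ‖complexKRDeriv δ gρ gπ k hk z - 1‖ < 25 * (2 * L / M) ^ 4 / max 1 (δ ⟨k, hk⟩) := by
  obtain ⟨t, ht, hzt⟩ := hlast
  rw [complexKRDeriv_eq, ← hzt]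
  exact (hρ.isComplexDensity_of_mem_krDomain hδ hM hk hz).norm_transport_div_sub_one_lt
    (isComplexDensity_complexKRMap hρ hπ hδ hM hk hz) ht

end ComplexKRMap

lemma DensityAssumption.toUnnormalized {d : ℕ} {M L C : ℝ} {δ : Fin d → ℝ}
    {f : (Fin d → ℝ) → ℝ} {g : (Fin d → ℂ) → ℂ} (h : DensityAssumption M L C δ f g)
    (hδ : ∀ i, 0 < δ i) : UnnormalizedDensityAssumption M L C δ f g where
  mem_Icc x hx := by
    have hbounds := h.bounds _ (toComplex_mem_polystrip hδ hx)
    rwa [h.extends_f x hx, Complex.norm_real, Real.norm_of_nonneg (h.density.pos x hx).le]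
      at hbounds
  extends_f := h.extends_f
  contDiffOn := h.contDiffOn
  small := h.small
  small_partial := h.small_partial

end KnotheRosenblatt

end

open KnotheRosenblatt in
theorem mainTheorem1_general (M L : ℝ) (hM : 0 < M) (hML : M ≤ L) :
    ∃ C₆ C₇ C₈ : ℝ, 0 < C₆ ∧ 0 < C₇ ∧ 0 < C₈ ∧
      ∀ (d : ℕ) (δ : Fin d → ℝ), (∀ i, 0 < δ i) →
      ∀ (fρ fπ : (Fin d → ℝ) → ℝ) (gρ gπ : (Fin d → ℂ) → ℂ),
        UnnormalizedDensityAssumption M L C₆ δ fρ gρ →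
        UnnormalizedDensityAssumption M L C₆ δ fπ gπ →
        ∀ k : Fin d, ∃ R : (Fin (k.val + 1) → ℂ) → ℂ,
          (∀ x ∈ cube (Fin (k.val + 1)),
            HasDerivWithinAt
              (fun s : ℝ => ((krComponent fρ fπ k.val
                (Function.update x (Fin.last k.val) s) : ℝ) : ℂ))
              (R (toComplex x)) (Set.Icc (-1 : ℝ) 1) (x (Fin.last k.val))) ∧
          ContDiffOn ℂ 1 R (polystrip
            fun i : Fin (k.val + 1) => C₇ * δ (Fin.castLE k.isLt i)) ∧
          (∀ z ∈ polystrip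
              (fun i : Fin (k.val + 1) => C₇ * δ (Fin.castLE k.isLt i)),
            R z ∈ Metric.ball (1 : ℂ) C₈ ∧ 1 / C₈ ≤ (R z).re) ∧
          (∀ z : Fin (k.val + 1) → ℂ,
            Fin.init z ∈ polystrip
              (fun i : Fin k.val => C₇ * δ (Fin.castLE k.isLt.le i)) →
            z (Fin.last k.val) ∈ complexInterval →
            R z ∈ Metric.ball (1 : ℂ) (C₈ / max 1 (δ k))) := by
  have hL : 0 < L := hM.trans_le hML
  refine ⟨maxVariation M L, (8 * (2 * L / M) ^ 2)⁻¹, 25 * (2 * L / M) ^ 4,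
    maxVariation_pos hM hML, by positivity, by positivity, ?_⟩
  intro d δ hδ fρ fπ gρ gπ hρ hπ k
  refine ⟨complexKRDeriv δ gρ gπ k k.isLt,
    fun x hx => hasDerivWithinAt_krComponent hρ hπ hδ hM k.isLt hx,
    contDiffOn_complexKRDeriv hρ hπ hδ hM k.isLt, fun z hz => ⟨?_, ?_⟩, fun z hz hlast => ?_⟩
  · exact mem_ball_iff_norm.2 (norm_complexKRDeriv_sub_one_lt hρ hπ hδ hM k.isLt hz)
  · exact inv_le_re_complexKRDeriv hρ hπ hδ hM k.isLt hz
  · exact mem_ball_iff_norm.2 (norm_complexKRDeriv_sub_one_lt_div hρ hπ hδ hM k.isLt hz hlast)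

theorem mainTheorem1 (M L : ℝ) (hM : 0 < M) (hML : M ≤ L) :
    ∃ C₆ C₇ C₈ : ℝ, 0 < C₆ ∧ 0 < C₇ ∧ 0 < C₈ ∧
      ∀ (d : ℕ) (δ : Fin d → ℝ), (∀ i, 0 < δ i) →
      ∀ (fρ fπ : (Fin d → ℝ) → ℝ) (gρ gπ : (Fin d → ℂ) → ℂ),
        KnotheRosenblatt.DensityAssumption M L C₆ δ fρ gρ →
        KnotheRosenblatt.DensityAssumption M L C₆ δ fπ gπ →
        ∀ k : Fin d, ∃ R : (Fin (k.val + 1) → ℂ) → ℂ,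
          -- `R` is the derivative of the `k`-th component in its last variable, on the real cube
          (∀ x ∈ KnotheRosenblatt.cube (Fin (k.val + 1)),
            HasDerivWithinAt
              (fun s : ℝ => ((KnotheRosenblatt.krComponent fρ fπ k.val
                (Function.update x (Fin.last k.val) s) : ℝ) : ℂ))
              (R (KnotheRosenblatt.toComplex x)) (Set.Icc (-1 : ℝ) 1) (x (Fin.last k.val))) ∧
          ContDiffOn ℂ 1 R (KnotheRosenblatt.polystrip
            fun i : Fin (k.val + 1) => C₇ * δ (Fin.castLE k.isLt i)) ∧
          (∀ z ∈ KnotheRosenblatt.polystrip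
              (fun i : Fin (k.val + 1) => C₇ * δ (Fin.castLE k.isLt i)),
            R z ∈ Metric.ball (1 : ℂ) C₈ ∧ 1 / C₈ ≤ (R z).re) ∧
          (1 ≤ k.val →
            ∀ z : Fin (k.val + 1) → ℂ,
              Fin.init z ∈ KnotheRosenblatt.polystrip
                (fun i : Fin k.val => C₇ * δ (Fin.castLE k.isLt.le i)) →
              z (Fin.last k.val) ∈ KnotheRosenblatt.complexInterval →
              R z ∈ Metric.ball (1 : ℂ) (C₈ / max 1 (δ k))) := by
  obtain ⟨C₆, C₇, C₈, hC₆, hC₇, hC₈, hKR⟩ := mainTheorem1_general M L hM hML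
  refine ⟨C₆, C₇, C₈, hC₆, hC₇, hC₈, fun d δ hδ fρ fπ gρ gπ hρ hπ k => ?_⟩
  obtain ⟨R, hderiv, hsmooth, hbounds, hlast⟩ :=
    hKR d δ hδ fρ fπ gρ gπ (hρ.toUnnormalized hδ) (hπ.toUnnormalized hδ) k
  exact ⟨R, hderiv, hsmooth, hbounds, fun _ => hlast⟩
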